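/- Let $I$, $J$, $O$ be the identity, all-ones and zero matrices (of the appropriate size), let $Y=2I-J$ and $N=\begin{bmatrix}0&0\\1&1\end{bmatrix}$ be of order $2$, and let $$R=R_{10}=\tfrac12\,\mathrm{circulant}(J,O,O,O,Y),$$ a $10\times10$ matrix with $2\times2$ blocks indexed by $\mathbb Z/5\mathbb Z$ (row $i$ has $J$ in position $(i,i)$ and $Y$ in position $(i,i-1)$). An adjacency matrix is a symmetric $01$-matrix with zero diagonal. Let $\mathcal B_R$ be the set of adjacency matrices $B$ for which $R^TBR$ is again an adjacency matrix; write $B_{ij}$ for the $2\times 2$ blocks of $B$. A regular orthogonal matrix is a real orthogonal matrix with constant row sum; a square matrix is decomposable if it becomes a nontrivial block-diagonal matrix after permuting rows and columns. A matrix $B\in\mathcal B_R$ is *reducible* if there are decomposable regular orthogonal matrices $R_1,\dots,R_s$ with $R=R_1\cdots R_s$ such that, putting $Q_i=\begin{bmatrix}R_i&O\\O&I\end{bmatrix}$ and $Q=\begin{bmatrix}R&O\\O&I\end{bmatrix}$, the matrix $(Q_1\cdots Q_i)^TA(Q_1\cdots Q_i)$ is an adjacency matrix for every $i<s$ and every adjacency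 matrix $A=\begin{bmatrix}B&V\\V^T&W\end{bmatrix}$ (of any size) for which $Q^TAQ$ is an adjacency matrix. Otherwise $B$ is *irreducible*. Call two matrices equivalent if one is obtained from the other by a finite sequence of the following operations and their inverses: $B\mapsto J-I-B$; replacing a block $B_{ij}$, $i\ne j$, together with $B_{ji}$, by $J-B_{ij}$ and $J-B_{ji}$; and $B\mapsto P^TBP$ with $P$ a permutation matrix such that $P^TRP'=R$ for some permutation matrix $P'$. **Theorem.** Up to equivalence, $\mathcal B_{R_{10}}$ has exactly three irreducible matrices. They are given by the following three cases. An adjacency matrix $B$ with $B_{ii}=O$ for all $i\in\mathbb Z/5\mathbb Z$ belongs to - case (a) if $B_{i,i+1}\in\{O,J\}$ and $B_{i,i+2}\in\{N,J-N\}$ for all $i$; - case (b) if $B_{i,i+1}\in\{I,J-I\}$ and $B_{i,i+2}\in\{N,J-N\}$ for all $i$; - case (c) if $B_{i,i+1}\in\{N,J-N\}$ and $B_{i,i+2}\in\{N^T,J-N^T\}$ for all $i$. Each case is nonempty, all its matrices are irreducible elements of $\mathcal B_{R_{10}}$, two matrices from these cases are equivalent if and only if they belong to the same case, and every irreducible matrix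 of $\mathcal B_{R_{10}}$ is equivalent to a matrix of one of the cases. Moreover, for $B$ in these cases, $B'=R^TBR$ is the adjacency matrix with $B'_{ii}=O$ and, for all $i$: in case (a) $B'_{i,i+1}=B_{i,i+1}$, $B'_{i,i+2}=B_{i,i+3}$; in case (b) $B'_{i,i+1}=B_{i+1,i+2}$, $B'_{i,i+2}=B_{i,i+3}$; in case (c) $B'_{i,i+1}=B_{i,i+2}$, $B'_{i,i+2}=B_{i+1,i+2}$. -/

import Mathlib

open Matrix

noncomputable section

namespace TenVertex

section General

variable {ι : Type} [Fintype ι] [DecidableEq ι]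

/-- A regular orthogonal matrix: real orthogonal with constant row sum. -/
def IsRegularOrthogonal (M : Matrix ι ι ℝ) : Prop :=
  M ∈ Matrix.orthogonalGroup ι ℝ ∧ ∃ r : ℝ, ∀ i, ∑ j, M i j = r

/-- `M` becomes a nontrivial block-diagonal matrix, with diagonal blocks indexed by `S` and
its complement, after a permutation `σ` of the rows and a permutation `τ` of the columns. -/
def IsDecomposable (M : Matrix ι ι ℝ) : Prop :=
  ∃ (σ τ : Equiv.Perm ι) (S : Set ι), S.Nonempty ∧ Sᶜ.Nonempty ∧
    ∀ i j, ((i ∈ S ∧ j ∉ S) ∨ (i ∉ S ∧ j ∈ S)) → M (σ i) (τ j) = 0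

/-- The set `𝓑_R` of adjacency matrices `B` for which `Rᵀ B R` is again an adjacency matrix. -/
def BSet (R : Matrix ι ι ℝ) : Set (Matrix ι ι ℝ) :=
  {B | B.IsAdjMatrix ∧ (Rᵀ * B * R).IsAdjMatrix}

/-- The matrix `Q = diag(R, I)`, where the identity block has size `n`. -/
def extend (n : ℕ) (R : Matrix ι ι ℝ) : Matrix (ι ⊕ Fin n) (ι ⊕ Fin n) ℝ :=
  Matrix.fromBlocks R 0 0 1

/-- `A` is the adjacency matrix of a graph containing the graph of `B` as the subgraph induced
on the switching set `ι` (with `n` outside vertices), to which the switching method of `R` can be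
applied: `Qᵀ A Q` is again an adjacency matrix. -/
def IsSwitchable (R B : Matrix ι ι ℝ) (n : ℕ) (A : Matrix (ι ⊕ Fin n) (ι ⊕ Fin n) ℝ) : Prop :=
  A.IsAdjMatrix ∧ A.toBlocks₁₁ = B ∧ ((extend n R)ᵀ * A * extend n R).IsAdjMatrix

/-- `B` is reducible with respect to `R`: there are decomposable regular orthogonal matrices
`R₁, …, R_s` (the list `L`) with `R = R₁ ⋯ R_s`, such that, for every `A` as above and every
`i < s`, conjugating `A` with `Q₁ ⋯ Q_i` gives an adjacency matrix. -/
def IsReducible (R B : Matrix ι ι ℝ) : Prop :=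
  ∃ L : List (Matrix ι ι ℝ),
    (∀ M ∈ L, IsRegularOrthogonal M ∧ IsDecomposable M) ∧
    R = L.prod ∧
    ∀ (n : ℕ) (A : Matrix (ι ⊕ Fin n) (ι ⊕ Fin n) ℝ), IsSwitchable R B n A →
      ∀ i < L.length,
        (((L.take i).map (extend n)).prodᵀ * A * ((L.take i).map (extend n)).prod).IsAdjMatrix

/-- The irreducible matrices of `𝓑_R`. -/
def IrreducibleSet (R : Matrix ι ι ℝ) : Set (Matrix ι ι ℝ) :=
  {B | B ∈ BSet R ∧ ¬ IsReducible R B}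

end General

/-- Vertices of the switching set: `(i, 0)` and `(i, 1)` are the two vertices of `C_i`. -/
abbrev Vtx : Type := ZMod 5 × Fin 2

abbrev Mat2 : Type := Matrix (Fin 2) (Fin 2) ℝ

abbrev Mat10 : Type := Matrix Vtx Vtx ℝ

/-- The `2 × 2` block `B_{ij}`. -/
def blk (B : Mat10) (i j : ZMod 5) : Mat2 := Matrix.of fun a b => B (i, a) (j, b)

/-- The matrix with prescribed `2 × 2` blocks. -/
def ofBlk (F : ZMod 5 → ZMod 5 → Mat2) : Mat10 := Matrix.of fun p q => F p.1 q.1 p.2 q.2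

/-- The all-ones `2 × 2` matrix. -/
def J₂ : Mat2 := !![1, 1; 1, 1]

/-- `Y = 2I - J`. -/
def Y₂ : Mat2 := !![1, -1; -1, 1]

def N₂ : Mat2 := !![0, 0; 1, 1]

/-- `R₁₀ = ½ circulant(J, O, O, O, Y)`. -/
def R10 : Mat10 :=
  (1 / 2 : ℝ) • ofBlk fun i j => if j = i then J₂ else if j = i - 1 then Y₂ else 0

/-- The complement of the whole matrix, `J - I - B`. -/
def fullCompl (B : Mat10) : Mat10 := (Matrix.of fun _ _ => 1) - 1 - B

/-- Replacement of the block `B_{ij}`, together with its transpose `B_{ji}`, by its complement. -/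
def blockCompl (i j : ZMod 5) (B : Mat10) : Mat10 :=
  ofBlk fun k l => if (k = i ∧ l = j) ∨ (k = j ∧ l = i) then J₂ - blk B k l else blk B k l

/-- The elementary operations: complementation of the whole matrix, complementation of an
off-diagonal block and its transpose, and conjugation with a permutation matrix `P` such that
`Pᵀ R₁₀ P' = R₁₀` for some permutation matrix `P'`. -/
inductive Step (B : Mat10) : Mat10 → Prop
  | full : Step B (fullCompl B)
  | block (i j : ZMod 5) (h : i ≠ j) : Step B (blockCompl i j B)
  | conj (σ τ : Equiv.Perm Vtx)
      (h : (σ.permMatrix ℝ)ᵀ * R10 * τ.permMatrix ℝ = R10) :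
      Step B ((σ.permMatrix ℝ)ᵀ * B * σ.permMatrix ℝ)

/-- Equality up to complementation and admissible conjugation. -/
def equivSetoid : Setoid Mat10 := Relation.EqvGen.setoid Step

/-- The equivalence classes of irreducible matrices of `𝓑_{R₁₀}`. -/
def IrreducibleClasses : Type :=
  Quotient (equivSetoid.comap (Subtype.val : IrreducibleSet R10 → Mat10))

/-- The block between `C_i` and `C_{i+1}`, up to complement, in each of the three cases. -/
def firstBlk : Fin 3 → Mat2 := ![0, 1, N₂]

/-- The block between `C_i` and `C_{i+2}`, up to complement, in each of the three cases. -/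
def secondBlk : Fin 3 → Mat2 := ![N₂, N₂, N₂ᵀ]

/-- `B` is the adjacency matrix of a ten vertex switching set of type (a), (b) or (c)
(`k = 0, 1, 2`): all `C_i` are edgeless, and every block between `C_i` and `C_{i+1}`, resp.
`C_{i+2}`, is the prescribed one or its complement (chosen independently for every block). -/
def IsTenVertexCase (k : Fin 3) (B : Mat10) : Prop :=
  B.IsAdjMatrix ∧ ∀ i : ZMod 5, blk B i i = 0 ∧
    (blk B i (i + 1) = firstBlk k ∨ blk B i (i + 1) = J₂ - firstBlk k) ∧
    (blk B i (i + 2) = secondBlk k ∨ blk B i (i + 2) = J₂ - secondBlk k)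

/-- `B'` arises from `B` by the replacement of induced subgraphs of type (a), (b) or (c):
the `C_i` stay edgeless, and
(a) `C_i ∪ C_{i+1}` is kept, and `C_i ∪ C_{i+2}` is replaced by the former `C_i ∪ C_{i+3}`;
(b) `C_i ∪ C_{i+1}` is replaced by the former `C_{i+1} ∪ C_{i+2}`, and `C_i ∪ C_{i+2}` by the
former `C_i ∪ C_{i+3}`;
(c) `C_i ∪ C_{i+1}` is replaced by the former `C_i ∪ C_{i+2}`, and `C_i ∪ C_{i+2}` by the
former `C_{i+1} ∪ C_{i+2}`. -/
def IsTenVertexSwitch (k : Fin 3) (B B' : Mat10) : Prop :=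
  B'.IsAdjMatrix ∧ ∀ i : ZMod 5, blk B' i i = 0 ∧
    blk B' i (i + 1) =
      (![blk B i (i + 1), blk B (i + 1) (i + 2), blk B i (i + 2)] : Fin 3 → Mat2) k ∧
    blk B' i (i + 2) =
      (![blk B i (i + 3), blk B i (i + 3), blk B (i + 1) (i + 2)] : Fin 3 → Mat2) k

end TenVertex

end

noncomputable section

namespace TenVertex

/-! ### Block types and the finite search -/

/-! On each pair `C_i` let `x_i = (1, 1)` and `y_i = (1, -1)`. For an injective `f` on `ZMod 5`,
`blockPerm f` is the orthogonal matrix that fixes every `x_i` and sends `y_i` to `y_{f i}`; `R10` is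
the one with `f = succ5`. Products correspond to compositions, so writing the 5-cycle `succ5` as a
product of two intransitive permutations factors `R10` into decomposable matrices.

Expand a `2 × 2` block in the products of these vectors, with coefficients `sumC`, `rowC`, `colC`,
`diagC`. Conjugation by `blockPerm f` only moves coefficients: the new block `(i, j)` takes its four
coefficients from the blocks `(i, j)`, `(i, f j)`, `(f i, j)`, `(f i, f j)`. If `B` lies in `BSet
R10`, parity forces all blocks to have even sum, so each off-diagonal block is `O`, `I`, `Nᵀ` or `N`
up to complement. Whether the conjugate is again an adjacency matrix then depends on these types
alone: this is `Valid` (`HasBlockTypes.isAdjMatrix_conj_iff`).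

A finite search over type tables (`search_types`) shows that a table valid for `succ5` is one of
three `caseTable`s or is valid for the first factor of some listed factorization. In the latter
situation `B` is reducible: outside vertices cause no trouble, since a vector admissible for `R10`
is admissible for every `blockPerm f`.

Conversely, let `B` have a case table and let `R10` be a product of decomposable matrices as in the
definition of reducibility. Testing a prefix product on all admissible outside vertices forces it to
be some `blockPerm f` up to a column permutation (`exists_eq_blockPerm_submatrix`), and
`caseTable_valid` leaves only `f = id` and `f = succ5`. At the first prefix with `f = succ5`, the
last factor is `R10` with permuted rows and columns, which is indecomposable: a contradiction.

Within a case, block complements connect all matrices. The cases are separated by two invariants of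
the blocks between consecutive parts: being constant, and being constant on both diagonals. -/

/-- The `01`-matrices of order two with even sum, up to complement: `O`, `I`, `Nᵀ`, `N`. -/
inductive BlockType
  | flat | diag | row | col

namespace BlockType

def swap : BlockType → BlockType
  | flat => flat
  | diag => diag
  | row => col
  | col => row

def isDiag : BlockType → ℕ
  | diag => 1
  | _ => 0

def isRow : BlockType → ℕ
  | row => 1
  | _ => 0

def isCol : BlockType → ℕ
  | col => 1
  | _ => 0

def nonFlat : BlockType → ℕ
  | flat => 0
  | _ => 1

instance decidableForall (p : BlockType → Prop) [DecidablePred p] : Decidable (∀ t, p t) :=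
  decidable_of_iff (p flat ∧ p diag ∧ p row ∧ p col)
    ⟨fun ⟨h₁, h₂, h₃, h₄⟩ t => by cases t <;> assumption, fun h => ⟨h _, h _, h _, h _⟩⟩

def beq : BlockType → BlockType → Bool
  | flat, flat => true
  | diag, diag => true
  | row, row => true
  | col, col => true
  | _, _ => false

instance : DecidableEq BlockType := fun s t =>
  decidable_of_iff (beq s t = true) (by cases s <;> cases t <;> simp [beq])

end BlockType

open BlockType

/-- The function on `ZMod 5` with prescribed values. -/
def pick {α : Type} (x₀ x₁ x₂ x₃ x₄ : α) : ZMod 5 → α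
  | ⟨0, _⟩ => x₀
  | ⟨1, _⟩ => x₁
  | ⟨2, _⟩ => x₂
  | ⟨3, _⟩ => x₃
  | ⟨4, _⟩ => x₄

lemma forall_zmod5 {p : ZMod 5 → Prop} : (∀ i, p i) ↔ p 0 ∧ p 1 ∧ p 2 ∧ p 3 ∧ p 4 := by
  refine ⟨fun h => ⟨h _, h _, h _, h _, h _⟩, ?_⟩
  rintro ⟨h₀, h₁, h₂, h₃, h₄⟩ i
  fin_cases i <;> assumption

lemma pick_self {α : Type} (f : ZMod 5 → α) : pick (f 0) (f 1) (f 2) (f 3) (f 4) = f :=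
  funext <| forall_zmod5.2 ⟨rfl, rfl, rfl, rfl, rfl⟩

abbrev succ5 : ZMod 5 → ZMod 5 := fun i => i + 1

/-- The condition on block types under which conjugation by `blockPerm f` gives a `01`-matrix. -/
def Valid (t : ZMod 5 → ZMod 5 → BlockType) (f : ZMod 5 → ZMod 5) : Prop :=
  ∀ i j, (t i j).nonFlat = (t i (f j)).isRow + (t (f i) j).isCol + (t (f i) (f j)).isDiag

instance (priority := high) decidableForallZMod5 (p : ZMod 5 → Prop) [DecidablePred p] :
    Decidable (∀ i, p i) :=
  decidable_of_iff _ forall_zmod5.symm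

instance (t : ZMod 5 → ZMod 5 → BlockType) (f : ZMod 5 → ZMod 5) : Decidable (Valid t f) :=
  inferInstanceAs (Decidable (∀ i j, (t i j).nonFlat =
    (t i (f j)).isRow + (t (f i) j).isCol + (t (f i) (f j)).isDiag))

/-- The symmetric table of block types determined by the types of the blocks at `(i, i + 1)`
and `(i, i + 2)`. -/
def typeTable (a b : ZMod 5 → BlockType) : ZMod 5 → ZMod 5 → BlockType :=
  pick (pick flat (a 0) (b 0) (b 3).swap (a 4).swap)
    (pick (a 0).swap flat (a 1) (b 1) (b 4).swap)
    (pick (b 0).swap (a 1).swap flat (a 2) (b 2))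
    (pick (b 3) (b 1).swap (a 2).swap flat (a 3))
    (pick (a 4) (b 4) (b 2).swap (a 3).swap flat)

lemma eq_typeTable {t : ZMod 5 → ZMod 5 → BlockType} (hd : ∀ i, t i i = flat)
    (hs : ∀ i j, t j i = (t i j).swap) :
    t = typeTable (fun i => t i (i + 1)) (fun i => t i (i + 2)) := by
  funext i
  revert i
  refine forall_zmod5.2 ⟨?_, ?_, ?_, ?_, ?_⟩ <;>
  refine funext (forall_zmod5.2 ⟨?_, ?_, ?_, ?_, ?_⟩) <;>
  first
    | exact hd _
    | rfl
    | exact hs _ _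

/-- Block permutations without transitive action whose cofactors in `succ5` have the same
property. -/
def factors : List ((ZMod 5 → ZMod 5) × (ZMod 5 → ZMod 5)) :=
  [(pick 0 1 4 3 2, pick 1 4 3 2 0), (pick 0 4 2 3 1, pick 4 2 3 1 0),
    (pick 3 2 1 4 0, pick 2 1 0 3 4), (pick 0 3 2 1 4, pick 3 2 1 4 0),
    (pick 1 2 0 4 3, pick 0 1 4 3 2), (pick 0 2 3 4 1, pick 4 1 2 3 0),
    (pick 1 2 3 0 4, pick 0 1 2 4 3), (pick 3 1 2 0 4, pick 1 2 0 4 3),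
    (pick 2 1 0 3 4, pick 1 0 3 4 2), (pick 0 2 1 4 3, pick 2 1 4 3 0),
    (pick 1 0 2 3 4, pick 0 2 3 4 1), (pick 0 1 3 4 2, pick 1 4 2 3 0),
    (pick 0 4 3 2 1, pick 4 3 2 1 0), (pick 0 2 3 1 4, pick 3 1 2 4 0),
    (pick 0 2 4 3 1, pick 4 1 3 2 0), (pick 0 3 2 4 1, pick 4 2 1 3 0)]

/-- Four iterates exhaust the orbit of `0` under an injective `f` unless the orbit has five points.
In that exceptional case the listed set is not invariant, so the invariance test in `factors_spec`
rejects it. -/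
def inOrbit (f : ZMod 5 → ZMod 5) (j : ZMod 5) : Bool :=
  j = 0 || j = f 0 || j = f (f 0) || j = f (f (f 0))

def Intransitive (f : ZMod 5 → ZMod 5) : Prop :=
  ∃ S : ZMod 5 → Bool, S 0 = true ∧ (∃ j, S j = false) ∧ ∀ i, S (f i) = S i

lemma factors_spec : ∀ w ∈ factors, w.1 ∘ w.2 = succ5 ∧
    (Function.Injective w.1 ∧ Function.Injective w.2) ∧ Intransitive w.1 ∧ Intransitive w.2 := by
  have h : factors.all (fun w => decide ((∀ i, w.1 (w.2 i) = i + 1) ∧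
      ((∀ i j, w.1 i = w.1 j → i = j) ∧ (∀ i j, w.2 i = w.2 j → i = j)) ∧
      ((¬ ∀ j, inOrbit w.1 j = true) ∧ ∀ i, inOrbit w.1 (w.1 i) = inOrbit w.1 i) ∧
      ((¬ ∀ j, inOrbit w.2 j = true) ∧ ∀ i, inOrbit w.2 (w.2 i) = inOrbit w.2 i))) = true := by
    decide +kernel
  intro w hw
  obtain ⟨h₁, h₂, h₃, h₄⟩ := of_decide_eq_true (List.all_eq_true.1 h w hw)
  simp only [not_forall, Bool.not_eq_true] at h₃ h₄
  exact ⟨funext h₁, ⟨h₂.1, h₂.2⟩, ⟨_, rfl, h₃⟩, ⟨_, rfl, h₄⟩⟩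

def firstType : Fin 3 → BlockType := ![flat, diag, col]

def secondType : Fin 3 → BlockType := ![col, col, row]

def caseTable (k : Fin 3) : ZMod 5 → ZMod 5 → BlockType :=
  typeTable (fun _ => firstType k) (fun _ => secondType k)

lemma caseTable_valid_succ : ∀ k, Valid (caseTable k) succ5 := by decide +kernel

set_option synthInstance.maxHeartbeats 0 in
set_option synthInstance.maxSize 1000 in
-- Rigidity of the three cases, checked over all 120 bijections: no block permutation lies strictly
-- between the identity and `R10`. This is the combinatorial source of irreducibility.
lemma caseTable_valid (k : Fin 3) (f : ZMod 5 → ZMod 5) (hf : Function.Injective f)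
    (h : Valid (caseTable k) f) : f = id ∨ f = succ5 := by
  have key : ∀ k : Fin 3, ∀ x₀ x₁ : ZMod 5, x₁ ≠ x₀ → ∀ x₂ : ZMod 5, x₂ ≠ x₀ → x₂ ≠ x₁ →
      ∀ x₃ : ZMod 5, x₃ ≠ x₀ → x₃ ≠ x₁ → x₃ ≠ x₂ →
      ∀ x₄ : ZMod 5, x₄ ≠ x₀ → x₄ ≠ x₁ → x₄ ≠ x₂ → x₄ ≠ x₃ →
      Valid (caseTable k) (pick x₀ x₁ x₂ x₃ x₄) →
      (∀ i, pick x₀ x₁ x₂ x₃ x₄ i = i) ∨ (∀ i, pick x₀ x₁ x₂ x₃ x₄ i = i + 1) := by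
    decide +kernel
  have hne : ∀ i j, i ≠ j → f i ≠ f j := fun i j hij h => hij (hf h)
  have := key k (f 0) (f 1) (hne _ _ (by decide)) (f 2) (hne _ _ (by decide))
    (hne _ _ (by decide)) (f 3) (hne _ _ (by decide)) (hne _ _ (by decide))
    (hne _ _ (by decide)) (f 4) (hne _ _ (by decide)) (hne _ _ (by decide))
    (hne _ _ (by decide)) (hne _ _ (by decide))
  rw [pick_self] at this
  exact (this h).imp funext funext

set_option synthInstance.maxHeartbeats 0 in
set_option synthInstance.maxSize 1000 in
-- Here `a i` and `b i` are the types at `(i, i + 1)` and `(i, i + 2)`, and the equations are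
-- `Valid` for `succ5` at `(i, i)`, `(i, i + 1)` and `(i, i + 2)`. The inequalities follow from the
-- equations; they and the interleaved order of the variables prune the search early.
lemma search_types :
    ∀ a₀, isRow a₀ = 0 → ∀ a₁, isRow a₁ = 0 → isDiag a₁ ≤ nonFlat a₀ →
    ∀ a₂, isRow a₂ = 0 → isDiag a₂ ≤ nonFlat a₁ → ∀ a₃, isRow a₃ = 0 → isDiag a₃ ≤ nonFlat a₂ →
    ∀ a₄, isRow a₄ = 0 → isDiag a₄ ≤ nonFlat a₃ → isDiag a₀ ≤ nonFlat a₄ →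
    ∀ b₀, nonFlat a₀ = isRow b₀ + isDiag a₁ → ∀ b₁, nonFlat a₁ = isRow b₁ + isDiag a₂ →
    ∀ b₃, nonFlat a₃ = isRow b₃ + isDiag a₄ →
    nonFlat b₀ = isCol b₃ + isCol a₁ + isDiag b₁ →
    ∀ b₂, nonFlat a₂ = isRow b₂ + isDiag a₃ →
    nonFlat b₂ = isCol b₀ + isCol a₃ + isDiag b₃ →
    ∀ b₄, nonFlat a₄ = isRow b₄ + isDiag a₀ →
    nonFlat b₁ = isCol b₄ + isCol a₂ + isDiag b₂ →
    nonFlat b₃ = isCol b₁ + isCol a₄ + isDiag b₄ →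
    nonFlat b₄ = isCol b₂ + isCol a₀ + isDiag b₀ →
    (∃ k : Fin 3, (∀ i, pick a₀ a₁ a₂ a₃ a₄ i = firstType k) ∧
      ∀ i, pick b₀ b₁ b₂ b₃ b₄ i = secondType k) ∨
    ∃ w ∈ factors, Valid (typeTable (pick a₀ a₁ a₂ a₃ a₄) (pick b₀ b₁ b₂ b₃ b₄)) w.1 := by
  decide +kernel

lemma isCol_swap (t : BlockType) : isCol t.swap = isRow t := by cases t <;> rfl

lemma eq_caseTable_or_valid_factor {t : ZMod 5 → ZMod 5 → BlockType} (hd : ∀ i, t i i = flat)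
    (hs : ∀ i j, t j i = (t i j).swap) (h : Valid t succ5) :
    (∃ k, t = caseTable k) ∨ ∃ w ∈ factors, Valid t w.1 := by
  have hr : ∀ i, isRow (t i (i + 1)) = 0 := by
    intro i
    have := h i i
    rw [hd, hd] at this
    change 0 = isRow (t i (i + 1)) + _ + 0 at this
    omega
  have h₁ : ∀ i, nonFlat (t i (i + 1)) =
      isRow (t i (i + 2)) + isDiag (t (i + 1) (i + 1 + 1)) := by
    intro i
    have := h i (i + 1)
    simp only [succ5, hd] at this
    rw [this, add_assoc i 1 1, one_add_one_eq_two]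
    rfl
  have h₂ : ∀ i, nonFlat (t i (i + 2)) = isCol (t (i + 3) (i + 3 + 2)) +
      isCol (t (i + 1) (i + 1 + 1)) + isDiag (t (i + 1) (i + 1 + 2)) := by
    intro i
    have := h i (i + 2)
    have e₁ : i + 2 + 1 = i + 3 := by rw [add_assoc]; rfl
    have e₂ : i + 1 + 2 = i + 3 := by rw [add_assoc]; rfl
    have e₃ : i + 1 + 1 = i + 2 := by rw [add_assoc]; rfl
    have e₄ : i + 3 + 2 = i := by rw [add_assoc, show (3 + 2 : ZMod 5) = 0 from rfl, add_zero]
    simp only [succ5, e₁] at this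
    rw [this, e₂, e₃, e₄, hs i (i + 3), isCol_swap]
  have ht := eq_typeTable hd hs
  generalize ha : (fun i => t i (i + 1)) = a at ht
  generalize hb : (fun i => t i (i + 2)) = b at ht
  simp only [fun i => show t i (i + 1) = a i from congrFun ha i,
    fun i => show t i (i + 2) = b i from congrFun hb i] at hr h₁ h₂
  have hle : ∀ i, isDiag (a (i + 1)) ≤ nonFlat (a i) := fun i => by rw [h₁]; omega
  have := search_types (a 0) (hr 0) (a 1) (hr 1) (hle 0) (a 2) (hr 2) (hle 1) (a 3) (hr 3) (hle 2)
    (a 4) (hr 4) (hle 3) (hle 4) (b 0) (h₁ 0) (b 1) (h₁ 1) (b 3) (h₁ 3) (h₂ 0) (b 2) (h₁ 2)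
    (h₂ 2) (b 4) (h₁ 4) (h₂ 1) (h₂ 3) (h₂ 4)
  rw [pick_self, pick_self] at this
  rw [ht]
  refine this.imp ?_ id
  rintro ⟨k, hk, hk'⟩
  exact ⟨k, by rw [caseTable, funext hk, funext hk']⟩

/-! ### Block permutation matrices -/

def sgn (a : Fin 2) : ℝ := if a = 0 then 1 else -1

@[simp] lemma sgn_zero : sgn 0 = 1 := rfl

@[simp] lemma sgn_one : sgn 1 = -1 := rfl

/-- The matrix `½ ∑ᵢ (xᵢ xᵢᵀ + y_{f i} yᵢᵀ)`, where `xᵢ` and `yᵢ` are the vectors `(1, 1)` and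
`(1, -1)` on the block `i`. -/
def blockPerm (f : ZMod 5 → ZMod 5) : Mat10 :=
  Matrix.of fun p q =>
    ((if p.1 = q.1 then 1 else 0) + sgn p.2 * sgn q.2 * (if p.1 = f q.1 then 1 else 0)) / 2

lemma mul_blockPerm_apply {m : Type*} (X : Matrix m Vtx ℝ) (f : ZMod 5 → ZMod 5) (p : m)
    (j : ZMod 5) (b : Fin 2) :
    (X * blockPerm f) p (j, b) =
      (X p (j, 0) + X p (j, 1) + sgn b * (X p (f j, 0) - X p (f j, 1))) / 2 := by
  simp only [Matrix.mul_apply, blockPerm, Matrix.of_apply, Fintype.sum_prod_type,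
    Fin.sum_univ_two, sgn_zero, sgn_one]
  have : ∀ x : ZMod 5, X p (x, 0) * (((if x = j then (1 : ℝ) else 0) +
      1 * sgn b * (if x = f j then 1 else 0)) / 2) + X p (x, 1) * (((if x = j then (1 : ℝ) else 0) +
      -1 * sgn b * (if x = f j then 1 else 0)) / 2) =
      (if x = j then (X p (x, 0) + X p (x, 1)) / 2 else 0) +
      (if x = f j then sgn b * (X p (x, 0) - X p (x, 1)) / 2 else 0) := by
    intro x
    split_ifs <;> ring
  rw [Finset.sum_congr rfl fun x _ => this x, Finset.sum_add_distrib, Finset.sum_ite_eq',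
    Finset.sum_ite_eq']
  simp only [Finset.mem_univ, if_true]
  ring

lemma blockPerm_transpose_mul_apply {m : Type*} (X : Matrix Vtx m ℝ) (f : ZMod 5 → ZMod 5)
    (q : m) (i : ZMod 5) (a : Fin 2) :
    ((blockPerm f)ᵀ * X) (i, a) q =
      (X (i, 0) q + X (i, 1) q + sgn a * (X (f i, 0) q - X (f i, 1) q)) / 2 := by
  have := mul_blockPerm_apply Xᵀ f q i a
  rw [← Matrix.transpose_apply (Xᵀ * blockPerm f), Matrix.transpose_mul,
    Matrix.transpose_transpose] at this
  exact this

lemma R10_eq : R10 = blockPerm succ5 := by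
  ext ⟨i, a⟩ ⟨j, b⟩
  have h : (j = i - 1) ↔ (i = j + 1) := by
    rw [eq_sub_iff_add_eq, eq_comm]
  have hne : i ≠ i - 1 := by
    intro h
    exact absurd (sub_eq_self.1 h.symm) (by decide)
  simp only [R10, ofBlk, blockPerm, Matrix.smul_apply, Matrix.of_apply, smul_eq_mul, ← h,
    eq_comm (a := i) (b := j)]
  by_cases h₁ : j = i
  · subst h₁
    rw [if_pos rfl, if_pos rfl, if_neg hne]
    fin_cases a <;> fin_cases b <;> norm_num [J₂]
  · rw [if_neg h₁, if_neg h₁]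
    by_cases h₂ : j = i - 1
    · rw [if_pos h₂, if_pos h₂]
      fin_cases a <;> fin_cases b <;> norm_num [Y₂]
    · rw [if_neg h₂, if_neg h₂]
      simp

lemma blockPerm_mul (f g : ZMod 5 → ZMod 5) : blockPerm f * blockPerm g = blockPerm (f ∘ g) := by
  ext ⟨i, a⟩ ⟨j, b⟩
  rw [mul_blockPerm_apply]
  simp only [blockPerm, Matrix.of_apply, sgn_zero, sgn_one, Function.comp_apply]
  ring

lemma blockPerm_id : blockPerm id = 1 := by
  ext ⟨i, a⟩ ⟨j, b⟩
  simp only [blockPerm, Matrix.of_apply, Matrix.one_apply, Prod.mk.injEq, id]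
  by_cases h : i = j
  · fin_cases a <;> fin_cases b <;> norm_num [h]
  · simp [h]

lemma blockPerm_transpose_mul_self {f : ZMod 5 → ZMod 5} (hf : Function.Injective f) :
    (blockPerm f)ᵀ * blockPerm f = 1 := by
  ext ⟨i, a⟩ ⟨j, b⟩
  rw [blockPerm_transpose_mul_apply]
  simp only [blockPerm, Matrix.of_apply, sgn_zero, sgn_one, Matrix.one_apply, Prod.mk.injEq,
    hf.eq_iff]
  by_cases h : i = j
  · fin_cases a <;> fin_cases b <;> simp [h] <;> split_ifs <;> norm_num
  · simp [h]
    split_ifs <;> ring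

lemma isRegularOrthogonal_blockPerm {f : ZMod 5 → ZMod 5} (hf : Function.Injective f) :
    IsRegularOrthogonal (blockPerm f) := by
  refine ⟨(Matrix.mem_orthogonalGroup_iff' _ _).2 ?_, 1, fun p => ?_⟩
  · exact blockPerm_transpose_mul_self hf
  · simp only [blockPerm, Matrix.of_apply, Fintype.sum_prod_type, Fin.sum_univ_two, sgn_zero,
      sgn_one]
    have : ∀ x : ZMod 5, ((if p.1 = x then (1 : ℝ) else 0) +
        sgn p.2 * 1 * (if p.1 = f x then 1 else 0)) / 2 + ((if p.1 = x then (1 : ℝ) else 0) +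
        sgn p.2 * -1 * (if p.1 = f x then 1 else 0)) / 2 = if p.1 = x then 1 else 0 := by
      intro x
      ring
    rw [Finset.sum_congr rfl fun x _ => this x]
    simp

/-- The entry at `(p, q)` vanishes unless `p.1` is `q.1` or `f q.1`, so an `f`-invariant set of
parts splits the matrix. -/
lemma isDecomposable_blockPerm {f : ZMod 5 → ZMod 5} (hf : Intransitive f) :
    IsDecomposable (blockPerm f) := by
  obtain ⟨S, h₀, ⟨j, hj⟩, hS⟩ := hf
  refine ⟨1, 1, {p | S p.1 = true}, ⟨(0, 0), h₀⟩, ⟨(j, 0), by simp [hj]⟩, ?_⟩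
  rintro p q hpq
  have h : S p.1 ≠ S q.1 := by
    rintro h
    simp only [Set.mem_ofPred_eq, h] at hpq
    tauto
  have h₁ : p.1 ≠ q.1 := fun e => h (by rw [e])
  have h₂ : p.1 ≠ f q.1 := fun e => h (by rw [e, hS])
  simp [blockPerm, h₁, h₂]

/-- A matrix with the entries of `R₁₀`, up to permutations of rows and columns, is
indecomposable. -/
lemma not_isDecomposable_submatrix (F G : Equiv.Perm Vtx) :
    ¬ IsDecomposable ((blockPerm succ5).submatrix F G) := by
  rintro ⟨σ, τ, S, ⟨x, hx⟩, ⟨y, hy⟩, h⟩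
  let A : Vtx → Prop := fun p => (σ.trans F).symm p ∈ S
  let C : Vtx → Prop := fun p => (τ.trans G).symm p ∈ S
  -- A nonzero entry puts its row and its column on the same side of the splitting. The support of
  -- `R10` is connected through the five parts, so everything ends up on one side.
  have key : ∀ p q, blockPerm succ5 p q ≠ 0 → (A p ↔ C q) := by
    intro p q hpq
    by_contra hAC
    refine hpq ?_
    have := h ((σ.trans F).symm p) ((τ.trans G).symm q) (by
      simp only [A, C] at hAC
      tauto)
    simpa [Matrix.submatrix_apply] using this
  have h₁₀ : (1 : ZMod 5) ≠ 0 := by decide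
  have h₁ : ∀ i a b, A (i, a) ↔ C (i, b) := by
    intro i a b
    refine key _ _ ?_
    fin_cases a <;> fin_cases b <;> simp [blockPerm, h₁₀]
  have h₂ : ∀ i a b, A (i + 1, a) ↔ C (i, b) := by
    intro i a b
    refine key _ _ ?_
    fin_cases a <;> fin_cases b <;> simp [blockPerm, h₁₀]
  have h₃ : ∀ i, A (i + 1, 0) ↔ A (i, 0) := fun i => (h₂ i 0 0).trans (h₁ i 0 0).symm
  have h₄ : ∀ i, A (i, 0) ↔ A (0, 0) := by
    have e₀ := h₃ 0
    have e₁ := h₃ 1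
    have e₂ := h₃ 2
    have e₃ := h₃ 3
    rw [show (0 + 1 : ZMod 5) = 1 from rfl] at e₀
    rw [show (1 + 1 : ZMod 5) = 2 from rfl] at e₁
    rw [show (2 + 1 : ZMod 5) = 3 from rfl] at e₂
    rw [show (3 + 1 : ZMod 5) = 4 from rfl] at e₃
    refine forall_zmod5.2 ⟨?_, ?_, ?_, ?_, ?_⟩ <;> tauto
  have h₅ : ∀ p, A p ↔ A (0, 0) := fun p =>
    ((h₁ p.1 p.2 0).trans (h₁ p.1 0 0).symm).trans (h₄ p.1)
  have hx' : A ((σ.trans F) x) := by simpa [A] using hx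
  have hy' : ¬ A ((σ.trans F) y) := by simpa [A] using hy
  exact hy' ((h₅ _).2 ((h₅ _).1 hx'))

/-! ### Block types of an adjacency matrix -/

def sumC (B : Mat10) (i j : ZMod 5) : ℝ :=
  B (i, 0) (j, 0) + B (i, 0) (j, 1) + B (i, 1) (j, 0) + B (i, 1) (j, 1)

def rowC (B : Mat10) (i j : ZMod 5) : ℝ :=
  B (i, 0) (j, 0) - B (i, 0) (j, 1) + B (i, 1) (j, 0) - B (i, 1) (j, 1)

def colC (B : Mat10) (i j : ZMod 5) : ℝ :=
  B (i, 0) (j, 0) + B (i, 0) (j, 1) - B (i, 1) (j, 0) - B (i, 1) (j, 1)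

def diagC (B : Mat10) (i j : ZMod 5) : ℝ :=
  B (i, 0) (j, 0) - B (i, 0) (j, 1) - B (i, 1) (j, 0) + B (i, 1) (j, 1)

lemma conj_blockPerm_apply (B : Mat10) (f : ZMod 5 → ZMod 5) (i j : ZMod 5) (a b : Fin 2) :
    ((blockPerm f)ᵀ * B * blockPerm f) (i, a) (j, b) =
      (sumC B i j + sgn b * rowC B i (f j) + sgn a * colC B (f i) j +
        sgn a * sgn b * diagC B (f i) (f j)) / 4 := by
  simp only [mul_blockPerm_apply, blockPerm_transpose_mul_apply, sumC, rowC, colC, diagC]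
  ring

def HasType (B : Mat10) (i j : ZMod 5) : BlockType → Prop
  | .flat => (sumC B i j = 0 ∨ sumC B i j = 4) ∧ rowC B i j = 0 ∧ colC B i j = 0 ∧ diagC B i j = 0
  | .diag => sumC B i j = 2 ∧ rowC B i j = 0 ∧ colC B i j = 0 ∧
      (diagC B i j = 2 ∨ diagC B i j = -2)
  | .row => sumC B i j = 2 ∧ (rowC B i j = 2 ∨ rowC B i j = -2) ∧ colC B i j = 0 ∧
      diagC B i j = 0
  | .col => sumC B i j = 2 ∧ rowC B i j = 0 ∧ (colC B i j = 2 ∨ colC B i j = -2) ∧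
      diagC B i j = 0

/-- An adjacency matrix with equal diagonal blocks whose off-diagonal blocks have even sum, with
the types given by `t`. -/
structure HasBlockTypes (B : Mat10) (t : ZMod 5 → ZMod 5 → BlockType) : Prop where
  adj : B.IsAdjMatrix
  diag_flat : ∀ i, t i i = flat
  hasType : ∀ i j, i ≠ j → HasType B i j (t i j)
  diag_const : ∀ i j, B (i, 0) (i, 1) = B (j, 0) (j, 1)

section

variable {B : Mat10} {i j : ZMod 5} {τ τ' : BlockType}

lemma HasType.sum_cases (h : HasType B i j τ) :
    (nonFlat τ = 0 ∧ (sumC B i j = 0 ∨ sumC B i j = 4)) ∨ (nonFlat τ = 1 ∧ sumC B i j = 2) := by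
  cases τ
  · exact Or.inl ⟨rfl, h.1⟩
  all_goals exact Or.inr ⟨rfl, h.1⟩

lemma HasType.row_cases (h : HasType B i j τ) :
    (isRow τ = 0 ∧ rowC B i j = 0) ∨ (isRow τ = 1 ∧ (rowC B i j = 2 ∨ rowC B i j = -2)) := by
  cases τ
  case row => exact Or.inr ⟨rfl, h.2.1⟩
  all_goals exact Or.inl ⟨rfl, h.2.1⟩

lemma HasType.col_cases (h : HasType B i j τ) :
    (isCol τ = 0 ∧ colC B i j = 0) ∨ (isCol τ = 1 ∧ (colC B i j = 2 ∨ colC B i j = -2)) := by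
  cases τ
  case col => exact Or.inr ⟨rfl, h.2.2.1⟩
  all_goals exact Or.inl ⟨rfl, h.2.2.1⟩

lemma HasType.diag_cases (h : HasType B i j τ) :
    (isDiag τ = 0 ∧ diagC B i j = 0) ∨
      (isDiag τ = 1 ∧ (diagC B i j = 2 ∨ diagC B i j = -2)) := by
  cases τ
  case diag => exact Or.inr ⟨rfl, h.2.2.2⟩
  all_goals exact Or.inl ⟨rfl, h.2.2.2⟩

lemma HasType.unique (h : HasType B i j τ) (h' : HasType B i j τ') : τ = τ' := by
  have h₁ := h.row_cases
  have h₂ := h'.row_cases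
  have h₃ := h.col_cases
  have h₄ := h'.col_cases
  have h₅ := h.diag_cases
  have h₆ := h'.diag_cases
  have e₁ : isRow τ = isRow τ' := by
    rcases h₁ with ⟨h₁, h₁'⟩ | ⟨h₁, h₁' | h₁'⟩ <;> rcases h₂ with ⟨h₂, h₂'⟩ | ⟨h₂, h₂' | h₂'⟩ <;>
      first | exact h₁.trans h₂.symm | (exfalso; linarith)
  have e₂ : isCol τ = isCol τ' := by
    rcases h₃ with ⟨h₁, h₁'⟩ | ⟨h₁, h₁' | h₁'⟩ <;> rcases h₄ with ⟨h₂, h₂'⟩ | ⟨h₂, h₂' | h₂'⟩ <;>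
      first | exact h₁.trans h₂.symm | (exfalso; linarith)
  have e₃ : isDiag τ = isDiag τ' := by
    rcases h₅ with ⟨h₁, h₁'⟩ | ⟨h₁, h₁' | h₁'⟩ <;> rcases h₆ with ⟨h₂, h₂'⟩ | ⟨h₂, h₂' | h₂'⟩ <;>
      first | exact h₁.trans h₂.symm | (exfalso; linarith)
  revert e₁ e₂ e₃
  clear h₁ h₂ h₃ h₄ h₅ h₆ h h'
  cases τ <;> cases τ' <;> simp [isRow, isCol, isDiag]

lemma sumC_swap (hB : B.IsSymm) : sumC B j i = sumC B i j := by
  simp only [sumC, hB.apply (i, _) (j, _)]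
  ring

lemma rowC_swap (hB : B.IsSymm) : rowC B j i = colC B i j := by
  simp only [rowC, colC, hB.apply (i, _) (j, _)]
  ring

lemma colC_swap (hB : B.IsSymm) : colC B j i = rowC B i j := by
  simp only [rowC, colC, hB.apply (i, _) (j, _)]
  ring

lemma diagC_swap (hB : B.IsSymm) : diagC B j i = diagC B i j := by
  simp only [diagC, hB.apply (i, _) (j, _)]
  ring

lemma HasType.swap (h : HasType B i j τ) (hB : B.IsSymm) : HasType B j i τ.swap := by
  have h₁ : sumC B j i = sumC B i j := sumC_swap hB
  have h₂ : rowC B j i = colC B i j := rowC_swap hB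
  have h₃ : colC B j i = rowC B i j := colC_swap hB
  have h₄ : diagC B j i = diagC B i j := diagC_swap hB
  cases τ <;> simp only [HasType, BlockType.swap, h₁, h₂, h₃, h₄] at h ⊢ <;> tauto

lemma coef_self (hB : B.IsAdjMatrix) (i : ZMod 5) :
    sumC B i i = 2 * B (i, 0) (i, 1) ∧ rowC B i i = 0 ∧ colC B i i = 0 ∧
      diagC B i i = -2 * B (i, 0) (i, 1) := by
  simp only [sumC, rowC, colC, diagC, hB.apply_diag, hB.symm.apply (i, 0) (i, 1)]
  refine ⟨?_, ?_, ?_, ?_⟩ <;> ring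

/-- `sumC` and `rowC` differ by twice a sum of entries, hence have the same parity. -/
lemma even_iff (hB : B.IsAdjMatrix) (i j : ZMod 5) :
    (sumC B i j = 0 ∨ sumC B i j = 2 ∨ sumC B i j = 4) ↔
      (rowC B i j = 0 ∨ rowC B i j = 2 ∨ rowC B i j = -2) := by
  simp only [sumC, rowC]
  rcases hB.zero_or_one (i, 0) (j, 0) with h₁ | h₁ <;>
  rcases hB.zero_or_one (i, 0) (j, 1) with h₂ | h₂ <;>
  rcases hB.zero_or_one (i, 1) (j, 0) with h₃ | h₃ <;>
  rcases hB.zero_or_one (i, 1) (j, 1) with h₄ | h₄ <;>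
  rw [h₁, h₂, h₃, h₄] <;> norm_num

lemma exists_hasType (hB : B.IsAdjMatrix)
    (h : sumC B i j = 0 ∨ sumC B i j = 2 ∨ sumC B i j = 4) : ∃ τ, HasType B i j τ := by
  suffices HasType B i j flat ∨ HasType B i j diag ∨ HasType B i j row ∨ HasType B i j col by
    rcases this with h | h | h | h <;> exact ⟨_, h⟩
  revert h
  simp only [HasType, sumC, rowC, colC, diagC]
  rcases hB.zero_or_one (i, 0) (j, 0) with h₁ | h₁ <;>
  rcases hB.zero_or_one (i, 0) (j, 1) with h₂ | h₂ <;>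
  rcases hB.zero_or_one (i, 1) (j, 0) with h₃ | h₃ <;>
  rcases hB.zero_or_one (i, 1) (j, 1) with h₄ | h₄ <;>
  rw [h₁, h₂, h₃, h₄] <;> norm_num

end

/-- For `01`-entries the sum of squares equals the sum, which by Parseval reads `s² + r² + c² + d² =
4s`, that is, `x + y + z = n`. Conversely, this count leaves only the coefficient patterns of
genuine `01`-blocks. -/
lemma zero_or_one_iff {s r c d : ℝ} {n x y z : ℕ}
    (hs : (n = 0 ∧ (s = 0 ∨ s = 4)) ∨ (n = 1 ∧ s = 2))
    (hr : (x = 0 ∧ r = 0) ∨ (x = 1 ∧ (r = 2 ∨ r = -2)))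
    (hc : (y = 0 ∧ c = 0) ∨ (y = 1 ∧ (c = 2 ∨ c = -2)))
    (hd : (z = 0 ∧ d = 0) ∨ (z = 1 ∧ (d = 2 ∨ d = -2))) :
    (∀ a b, (s + sgn b * r + sgn a * c + sgn a * sgn b * d) / 4 = 0 ∨
      (s + sgn b * r + sgn a * c + sgn a * sgn b * d) / 4 = 1) ↔ n = x + y + z := by
  simp only [Fin.forall_fin_two, sgn_zero, sgn_one]
  rcases hs with ⟨rfl, rfl | rfl⟩ | ⟨rfl, rfl⟩ <;> rcases hr with ⟨rfl, rfl⟩ | ⟨rfl, rfl | rfl⟩ <;>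
    rcases hc with ⟨rfl, rfl⟩ | ⟨rfl, rfl | rfl⟩ <;>
    rcases hd with ⟨rfl, rfl⟩ | ⟨rfl, rfl | rfl⟩ <;> norm_num

section

variable {B : Mat10} {t : ZMod 5 → ZMod 5 → BlockType}

lemma HasBlockTypes.row_cases (h : HasBlockTypes B t) (i j : ZMod 5) :
    (isRow (t i j) = 0 ∧ rowC B i j = 0) ∨
      (isRow (t i j) = 1 ∧ (rowC B i j = 2 ∨ rowC B i j = -2)) := by
  by_cases hij : i = j
  · subst hij
    rw [h.diag_flat]
    exact Or.inl ⟨rfl, (coef_self h.adj i).2.1⟩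
  · exact (h.hasType i j hij).row_cases

lemma HasBlockTypes.col_cases (h : HasBlockTypes B t) (i j : ZMod 5) :
    (isCol (t i j) = 0 ∧ colC B i j = 0) ∨
      (isCol (t i j) = 1 ∧ (colC B i j = 2 ∨ colC B i j = -2)) := by
  by_cases hij : i = j
  · subst hij
    rw [h.diag_flat]
    exact Or.inl ⟨rfl, (coef_self h.adj i).2.2.1⟩
  · exact (h.hasType i j hij).col_cases

lemma HasBlockTypes.swap (h : HasBlockTypes B t) (i j : ZMod 5) : t j i = (t i j).swap := by
  by_cases hij : i = j
  · subst hij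
    rw [h.diag_flat]
    rfl
  · exact (h.hasType j i (Ne.symm hij)).unique ((h.hasType i j hij).swap h.adj.symm)

lemma isSymm_conj {m n : Type*} [Fintype m] {A : Matrix m m ℝ} (hA : A.IsSymm)
    (P : Matrix m n ℝ) : (Pᵀ * A * P).IsSymm := by
  rw [Matrix.IsSymm, Matrix.transpose_mul, Matrix.transpose_mul, Matrix.transpose_transpose,
    hA.eq, Matrix.mul_assoc]

/-- Off the diagonal this is `zero_or_one_iff` block by block. Diagonal blocks count as `flat` even
when they equal `J - I`: as all of them are equal, their sum and diagonal coefficients recombine to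
the same block, and the only condition left is that `rowC B i (f i)` vanishes. -/
theorem HasBlockTypes.isAdjMatrix_conj_iff (h : HasBlockTypes B t) {f : ZMod 5 → ZMod 5}
    (hf : Function.Injective f) :
    ((blockPerm f)ᵀ * B * blockPerm f).IsAdjMatrix ↔ Valid t f := by
  have key : ∀ i j, i ≠ j → _ := fun i j hij => zero_or_one_iff (h.hasType i j hij).sum_cases
    (h.row_cases i (f j)) (h.col_cases (f i) j)
    (h.hasType (f i) (f j) (fun e => hij (hf e))).diag_cases
  have hself : ∀ i a b, ((blockPerm f)ᵀ * B * blockPerm f) (i, a) (i, b) =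
      (2 * B (i, 0) (i, 1) * (1 - sgn a * sgn b) + (sgn a + sgn b) * rowC B i (f i)) / 4 := by
    intro i a b
    rw [conj_blockPerm_apply, (coef_self h.adj i).1, (coef_self h.adj (f i)).2.2.2,
      colC_swap h.adj.symm, h.diag_const (f i) i]
    ring
  constructor
  · intro hA i j
    by_cases hij : i = j
    · subst hij
      have h₀ : rowC B i (f i) = 0 := by
        have := hA.apply_diag (i, 0)
        rw [hself, sgn_zero] at this
        linarith
      have h₁ : isRow (t i (f i)) = 0 := by
        rcases h.row_cases i (f i) with e | ⟨-, e | e⟩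
        · exact e.1
        · linarith
        · linarith
      rw [h.diag_flat, h.diag_flat, h₁, h.swap i (f i), isCol_swap, h₁]
      rfl
    · refine (key i j hij).1 fun a b => ?_
      have := hA.zero_or_one (i, a) (j, b)
      rwa [conj_blockPerm_apply] at this
  · intro hv
    have h₀ : ∀ i, rowC B i (f i) = 0 := by
      intro i
      have := hv i i
      rw [h.diag_flat, h.diag_flat] at this
      change 0 = isRow _ + _ + 0 at this
      rcases h.row_cases i (f i) with e | e
      · exact e.2
      · omega
    refine ⟨?_, isSymm_conj h.adj.symm _, ?_⟩
    · rintro ⟨i, a⟩ ⟨j, b⟩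
      by_cases hij : i = j
      · subst hij
        rw [hself, h₀]
        rcases h.adj.zero_or_one (i, 0) (i, 1) with e | e <;> rw [e] <;>
          fin_cases a <;> fin_cases b <;> norm_num
      · rw [conj_blockPerm_apply]
        exact (key i j hij).2 (hv i j) a b
    · rintro ⟨i, a⟩
      rw [hself, h₀]
      fin_cases a <;> norm_num

end

/-! ### Block types of the elements of `BSet R10` -/

theorem exists_hasBlockTypes {B : Mat10} (hB : B ∈ BSet R10) :
    ∃ t, HasBlockTypes B t ∧ Valid t succ5 := by
  obtain ⟨hA, hA'⟩ := hB
  rw [R10_eq] at hA'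
  set B' := (blockPerm succ5)ᵀ * B * blockPerm succ5 with hB'
  have happ : ∀ i j a b, B' (i, a) (j, b) = _ := fun i j a b => conj_blockPerm_apply B succ5 i j a b
  have hs : ∀ i j, sumC B' i j = sumC B i j := by
    intro i j
    rw [sumC, happ, happ, happ, happ, sgn_zero, sgn_one]
    ring
  have hr : ∀ i j, rowC B' i j = rowC B i (j + 1) := by
    intro i j
    rw [rowC, happ, happ, happ, happ, sgn_zero, sgn_one]
    ring
  have hd : ∀ i j, diagC B' i j = diagC B (i + 1) (j + 1) := by
    intro i j
    rw [diagC, happ, happ, happ, happ, sgn_zero, sgn_one]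
    ring
  have heven : ∀ i j, sumC B i j = 0 ∨ sumC B i j = 2 ∨ sumC B i j = 4 := by
    intro i
    have h₀ : sumC B i (i + 0) = 0 ∨ sumC B i (i + 0) = 2 ∨ sumC B i (i + 0) = 4 := by
      rw [add_zero, (coef_self hA i).1]
      rcases hA.zero_or_one (i, 0) (i, 1) with e | e <;> rw [e] <;> norm_num
    -- The block `(i, j)` of `B'` has the sum of `B_{i,j}` and the row coefficient of `B_{i,j+1}`,
    -- so evenness passes from `j` to `j + 1`, starting at the symmetric block `j = i`.
    have hstep : ∀ j, (sumC B i j = 0 ∨ sumC B i j = 2 ∨ sumC B i j = 4) →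
        (sumC B i (j + 1) = 0 ∨ sumC B i (j + 1) = 2 ∨ sumC B i (j + 1) = 4) := by
      intro j hj
      rw [even_iff hA, ← hr, ← even_iff hA', hs]
      exact hj
    have h₁ := hstep _ h₀
    have h₂ := hstep _ h₁
    have h₃ := hstep _ h₂
    have h₄ := hstep _ h₃
    simp only [add_assoc] at h₁ h₂ h₃ h₄
    intro j
    rw [← add_sub_cancel i j]
    generalize j - i = n
    revert n
    exact forall_zmod5.2 ⟨h₀, h₁, h₂, h₃, h₄⟩
  have hdiag : ∀ i, B (i + 1, 0) (i + 1, 1) = B (i, 0) (i, 1) := by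
    intro i
    have h₁ := hs i i
    have h₂ := hd i i
    rw [(coef_self hA' i).1, (coef_self hA i).1] at h₁
    rw [(coef_self hA' i).2.2.2, (coef_self hA (i + 1)).2.2.2] at h₂
    linarith
  choose t ht using fun i j => exists_hasType hA (heven i j)
  have hconst : ∀ i, B (i, 0) (i, 1) = B (0, 0) (0, 1) := by
    have e₀ := hdiag 0
    have e₁ := (hdiag 1).trans e₀
    have e₂ := (hdiag 2).trans e₁
    have e₃ := (hdiag 3).trans e₂
    exact forall_zmod5.2 ⟨rfl, e₀, e₁, e₂, e₃⟩
  have h : HasBlockTypes B (fun i j => if i = j then flat else t i j) := by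
    refine ⟨hA, fun i => if_pos rfl, fun i j hij => ?_, fun i j => ?_⟩
    · rw [if_neg hij]
      exact ht i j
    · rw [hconst i, hconst j]
  exact ⟨_, h, (h.isAdjMatrix_conj_iff (add_left_injective 1)).1 hA'⟩

/-! ### Extensions by outside vertices -/

lemma extend_one {ι : Type} [DecidableEq ι] {n : ℕ} :
    extend n (1 : Matrix ι ι ℝ) = 1 := Matrix.fromBlocks_one

lemma extend_mul {ι : Type} [Fintype ι] {n : ℕ} (P Q : Matrix ι ι ℝ) :
    extend n (P * Q) = extend n P * extend n Q := by
  simp [extend, Matrix.fromBlocks_multiply]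

lemma prod_map_extend {ι : Type} [Fintype ι] [DecidableEq ι] {n : ℕ} (L : List (Matrix ι ι ℝ)) :
    (L.map (extend n)).prod = extend n L.prod := by
  induction L with
  | nil => simp [extend_one]
  | cons P L ih => simp [extend_mul, ih]

lemma extend_conj {ι : Type} [Fintype ι] {n : ℕ} (P : Matrix ι ι ℝ)
    (A : Matrix (ι ⊕ Fin n) (ι ⊕ Fin n) ℝ) :
    (extend n P)ᵀ * A * extend n P = Matrix.fromBlocks (Pᵀ * A.toBlocks₁₁ * P)
      (Pᵀ * A.toBlocks₁₂) (A.toBlocks₂₁ * P) A.toBlocks₂₂ := by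
  conv_lhs => rw [← Matrix.fromBlocks_toBlocks A]
  simp [extend, Matrix.fromBlocks_transpose, Matrix.fromBlocks_multiply]

lemma isAdjMatrix_extend_conj_iff {ι : Type} [Fintype ι] {n : ℕ}
    {A : Matrix (ι ⊕ Fin n) (ι ⊕ Fin n) ℝ} (hA : A.IsAdjMatrix)
    (P : Matrix ι ι ℝ) : ((extend n P)ᵀ * A * extend n P).IsAdjMatrix ↔
      (Pᵀ * A.toBlocks₁₁ * P).IsAdjMatrix ∧
        ∀ p v, (Pᵀ * A.toBlocks₁₂) p v = 0 ∨ (Pᵀ * A.toBlocks₁₂) p v = 1 := by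
  have hs := isSymm_conj hA.symm (extend n P)
  rw [extend_conj] at hs ⊢
  constructor
  · intro h
    exact ⟨⟨fun p q => h.zero_or_one (Sum.inl p) (Sum.inl q),
      Matrix.IsSymm.ext fun p q => h.symm.apply (Sum.inl p) (Sum.inl q),
      fun p => h.apply_diag (Sum.inl p)⟩, fun p v => h.zero_or_one (Sum.inl p) (Sum.inr v)⟩
  · rintro ⟨h₁, h₂⟩
    refine ⟨?_, hs, ?_⟩
    · rintro (p | v) (q | w)
      · exact h₁.zero_or_one p q
      · exact h₂ p w
      · rw [← hs.apply]
        exact h₂ q v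
      · exact hA.zero_or_one (Sum.inr v) (Sum.inr w)
    · rintro (p | v)
      · exact h₁.apply_diag p
      · exact hA.apply_diag (Sum.inr v)

/-! ### Reducible matrices -/

/-- Admissibility for `succ5` means that a vector is constant on all five pairs or on none of them,
a condition in which `f` plays no role. -/
lemma isSwitchingVector_blockPerm {n : ℕ} {X : Matrix Vtx (Fin n) ℝ}
    (hX : ∀ p v, X p v = 0 ∨ X p v = 1)
    (h : ∀ p v, ((blockPerm succ5)ᵀ * X) p v = 0 ∨ ((blockPerm succ5)ᵀ * X) p v = 1)
    (f : ZMod 5 → ZMod 5) (p : Vtx) (v : Fin n) :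
    ((blockPerm f)ᵀ * X) p v = 0 ∨ ((blockPerm f)ᵀ * X) p v = 1 := by
  have hstep : ∀ i : ZMod 5, (X (i + 1, 0) v = X (i + 1, 1) v ↔ X (i, 0) v = X (i, 1) v) := by
    intro i
    have h₀ := h (i, 0) v
    have h₁ := h (i, 1) v
    rw [blockPerm_transpose_mul_apply] at h₀ h₁
    rw [sgn_zero] at h₀
    rw [sgn_one] at h₁
    revert h₀ h₁
    rcases hX (i, 0) v with e₁ | e₁ <;> rcases hX (i, 1) v with e₂ | e₂ <;>
    rcases hX (i + 1, 0) v with e₃ | e₃ <;> rcases hX (i + 1, 1) v with e₄ | e₄ <;>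
    rw [e₁, e₂, e₃, e₄] <;> norm_num
  have e₀ := hstep 0
  have e₁ := (hstep 1).trans e₀
  have e₂ := (hstep 2).trans e₁
  have e₃ := (hstep 3).trans e₂
  have hall : ∀ i : ZMod 5, (X (i, 0) v = X (i, 1) v ↔ X (0, 0) v = X (0, 1) v) :=
    forall_zmod5.2 ⟨Iff.rfl, e₀, e₁, e₂, e₃⟩
  obtain ⟨i, a⟩ := p
  have hi := (hall i).trans (hall (f i)).symm
  rw [blockPerm_transpose_mul_apply]
  revert hi
  rcases hX (i, 0) v with e₁ | e₁ <;> rcases hX (i, 1) v with e₂ | e₂ <;>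
  rcases hX (f i, 0) v with e₃ | e₃ <;> rcases hX (f i, 1) v with e₄ | e₄ <;>
  rw [e₁, e₂, e₃, e₄] <;> fin_cases a <;> norm_num

theorem HasBlockTypes.isReducible {B : Mat10} {t : ZMod 5 → ZMod 5 → BlockType}
    (h : HasBlockTypes B t) {w : (ZMod 5 → ZMod 5) × (ZMod 5 → ZMod 5)} (hw : w ∈ factors)
    (hv : Valid t w.1) : IsReducible R10 B := by
  obtain ⟨hcomp, ⟨hf, hg⟩, hf', hg'⟩ := factors_spec w hw
  refine ⟨[blockPerm w.1, blockPerm w.2], ?_, ?_, ?_⟩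
  · simp only [List.mem_cons, List.not_mem_nil, or_false]
    rintro M (rfl | rfl)
    · exact ⟨isRegularOrthogonal_blockPerm hf, isDecomposable_blockPerm hf'⟩
    · exact ⟨isRegularOrthogonal_blockPerm hg, isDecomposable_blockPerm hg'⟩
  · simp [blockPerm_mul, hcomp, R10_eq]
  · rintro n A ⟨hA, rfl, hA'⟩ i hi
    rw [prod_map_extend, isAdjMatrix_extend_conj_iff hA]
    rw [R10_eq, isAdjMatrix_extend_conj_iff hA] at hA'
    have hX : ∀ p v, A.toBlocks₁₂ p v = 0 ∨ A.toBlocks₁₂ p v = 1 :=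
      fun p v => hA.zero_or_one (Sum.inl p) (Sum.inr v)
    simp only [List.length_cons, List.length_nil] at hi
    -- Only the empty prefix and the first factor need checking.
    interval_cases i
    · simpa only [List.take_zero, List.prod_nil, Matrix.transpose_one, Matrix.one_mul,
        Matrix.mul_one] using ⟨h.adj, hX⟩
    · simp only [List.take_succ_cons, List.take_zero, List.prod_singleton]
      exact ⟨(h.isAdjMatrix_conj_iff hf).2 hv, isSwitchingVector_blockPerm hX hA'.2 w.1⟩

/-! ### Irreducible matrices -/

/-- The neighbourhoods in the switching set of the outside vertices. -/
def IsSwitchingVector (v : Vtx → ℝ) : Prop :=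
  (∀ p, v p = 0 ∨ v p = 1) ∧ ∀ q, v ⬝ᵥ (fun p => R10 p q) = 0 ∨ v ⬝ᵥ (fun p => R10 p q) = 1

lemma dotProduct_R10 (v : Vtx → ℝ) (j : ZMod 5) (b : Fin 2) :
    v ⬝ᵥ (fun p => R10 p (j, b)) =
      (v (j, 0) + v (j, 1) + sgn b * (v (j + 1, 0) - v (j + 1, 1))) / 2 := by
  rw [R10_eq]
  exact mul_blockPerm_apply (Matrix.of fun (_ : Unit) p => v p) succ5 () j b

lemma isSwitchingVector_const (u : Finset (ZMod 5)) :
    IsSwitchingVector (fun p => if p.1 ∈ u then 1 else 0) := by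
  refine ⟨fun p => ?_, fun ⟨j, b⟩ => ?_⟩
  · dsimp only
    split_ifs <;> simp
  · rw [dotProduct_R10]
    dsimp only
    split_ifs <;> norm_num

lemma isSwitchingVector_nonconst (u : Finset (ZMod 5)) :
    IsSwitchingVector (fun p => if p.2 = (if p.1 ∈ u then 1 else 0) then 1 else 0) := by
  refine ⟨fun p => ?_, fun ⟨j, b⟩ => ?_⟩
  · dsimp only
    split_ifs <;> simp
  · rw [dotProduct_R10]
    dsimp only
    fin_cases b <;> by_cases h₁ : j ∈ u <;> by_cases h₂ : j + 1 ∈ u <;> simp [h₁, h₂]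

lemma sum_sq_of_pairwise {γ : ZMod 5 → ℝ} (h : ∀ i, γ i ^ 2 = 0 ∨ γ i ^ 2 = 1)
    (h' : ∀ i j, i ≠ j → γ i = 0 ∨ γ j = 0) :
    ∑ i, γ i ^ 2 = 0 ∨ ∑ i, γ i ^ 2 = 1 ∧ ∃ i, γ i ^ 2 = 1 ∧ ∀ j, j ≠ i → γ j = 0 := by
  by_cases h₀ : ∀ i, γ i = 0
  · simp [h₀]
  · push Not at h₀
    obtain ⟨i, hi⟩ := h₀
    have hj : ∀ j, j ≠ i → γ j = 0 := fun j hj => (h' i j hj.symm).resolve_left hi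
    have hi' : γ i ^ 2 = 1 := (h i).resolve_left (pow_ne_zero 2 hi)
    refine Or.inr ⟨?_, i, hi', hj⟩
    rw [Finset.sum_eq_single i (fun j _ e => by rw [hj j e]; ring) (by simp), hi']

/-- Vectors constant on pairs make every subset sum of the `α i` equal to `0` or `1`, so at most one
`α i` is nonzero, and it is `1`. Vectors choosing one vertex per pair similarly allow at most one
nonzero `β i`, equal to `±1`. The norm condition `∑ α² + ∑ β² = 2` then makes exactly one of each
nonzero. -/
lemma column_eq {x : Vtx → ℝ} (hn : ∑ p, x p * x p = 1)
    (hx : ∀ v, IsSwitchingVector v → v ⬝ᵥ x = 0 ∨ v ⬝ᵥ x = 1) :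
    ∃ (i j : ZMod 5) (a : Fin 2), ∀ p : Vtx, x p =
      ((if p.1 = i then 1 else 0) + sgn p.2 * sgn a * (if p.1 = j then 1 else 0)) / 2 := by
  let α : ZMod 5 → ℝ := fun i => x (i, 0) + x (i, 1)
  let β : ZMod 5 → ℝ := fun i => x (i, 0) - x (i, 1)
  have hα : ∀ u : Finset (ZMod 5), ∑ i ∈ u, α i = 0 ∨ ∑ i ∈ u, α i = 1 := by
    intro u
    have := hx _ (isSwitchingVector_const u)
    simp only [dotProduct, Fintype.sum_prod_type, Fin.sum_univ_two, ite_mul, one_mul,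
      zero_mul] at this
    have e : ∀ i, ((if i ∈ u then x (i, 0) else 0) + if i ∈ u then x (i, 1) else 0) =
        if i ∈ u then α i else 0 := by
      intro i
      split_ifs <;> simp [α]
    simpa only [e, Finset.sum_ite_mem, Finset.univ_inter] using this
  have hβ : ∀ u : Finset (ZMod 5), ∑ i, x (i, 0) - ∑ i ∈ u, β i = 0 ∨
      ∑ i, x (i, 0) - ∑ i ∈ u, β i = 1 := by
    intro u
    have := hx _ (isSwitchingVector_nonconst u)
    simp only [dotProduct, Fintype.sum_prod_type, Fin.sum_univ_two, ite_mul, one_mul,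
      zero_mul] at this
    have e : ∀ i, ((if (0 : Fin 2) = (if i ∈ u then 1 else 0) then x (i, 0) else 0) +
        if (1 : Fin 2) = (if i ∈ u then 1 else 0) then x (i, 1) else 0) =
        x (i, 0) - if i ∈ u then β i else 0 := by
      intro i
      by_cases hi : i ∈ u <;> simp [hi, β]
    simpa only [e, Finset.sum_sub_distrib, Finset.sum_ite_mem, Finset.univ_inter] using this
  have hα₁ : ∀ i, α i = 0 ∨ α i = 1 := fun i => by simpa using hα {i}
  have hα₂ : ∀ i j, i ≠ j → α i = 0 ∨ α j = 0 := by
    intro i j hij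
    have := hα {i, j}
    rw [Finset.sum_pair hij] at this
    rcases hα₁ i with e | e <;> rcases hα₁ j with e' | e' <;> rw [e, e'] at this ⊢ <;>
      first | (norm_num; done) | (norm_num at this)
  have hβ₀ := hβ ∅
  rw [Finset.sum_empty, sub_zero] at hβ₀
  have hβ₁ : ∀ i, β i = 0 ∨ β i = 1 ∨ β i = -1 := by
    intro i
    have := hβ {i}
    rw [Finset.sum_singleton] at this
    rcases hβ₀ with e | e <;> rw [e] at this <;> rcases this with h | h
    · exact Or.inl (by linarith)
    · exact Or.inr (Or.inr (by linarith))
    · exact Or.inr (Or.inl (by linarith))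
    · exact Or.inl (by linarith)
  have hβ₂ : ∀ i j, i ≠ j → β i = 0 ∨ β j = 0 := by
    intro i j hij
    have h₁ := hβ {i}
    have h₂ := hβ {j}
    have h₃ := hβ {i, j}
    rw [Finset.sum_singleton] at h₁ h₂
    rw [Finset.sum_pair hij] at h₃
    rcases hβ₀ with e | e <;> rw [e] at h₁ h₂ h₃ <;>
      rcases hβ₁ i with e₁ | e₁ | e₁ <;> rcases hβ₁ j with e₂ | e₂ | e₂ <;>
      rw [e₁] at h₁ h₃ ⊢ <;> rw [e₂] at h₂ h₃ ⊢ <;>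
      first
        | (norm_num; done)
        | (norm_num at h₁; done)
        | (norm_num at h₂; done)
        | norm_num at h₃
  have hsum : ∑ i, α i ^ 2 + ∑ i, β i ^ 2 = 2 := by
    rw [Fintype.sum_prod_type] at hn
    rw [← Finset.sum_add_distrib, show (2 : ℝ) = 2 * 1 by norm_num, ← hn, Finset.mul_sum]
    refine Finset.sum_congr rfl fun i _ => ?_
    simp only [Fin.sum_univ_two, α, β]
    ring
  have hα' := sum_sq_of_pairwise (γ := α)
    (fun i => by rcases hα₁ i with e | e <;> rw [e] <;> norm_num) hα₂
  have hβ' := sum_sq_of_pairwise (γ := β)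
    (fun i => by rcases hβ₁ i with e | e | e <;> rw [e] <;> norm_num) hβ₂
  obtain ⟨-, i, hi, hi'⟩ := hα'.resolve_left (fun e => by
    rcases hβ' with e' | ⟨e', -⟩ <;> linarith)
  obtain ⟨-, j, hj, hj'⟩ := hβ'.resolve_left (fun e => by
    rcases hα' with e' | ⟨e', -⟩ <;> linarith)
  have hαi : α i = 1 := by
    rcases hα₁ i with e | e
    · rw [e] at hi
      norm_num at hi
    · exact e
  obtain ⟨a, ha⟩ : ∃ a, β j = sgn a := by
    rcases hβ₁ j with e | e | e
    · rw [e] at hj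
      norm_num at hj
    · exact ⟨0, by rw [e, sgn_zero]⟩
    · exact ⟨1, by rw [e, sgn_one]⟩
  have hα'' : ∀ k, α k = if k = i then 1 else 0 := by
    intro k
    split_ifs with e
    · rw [e, hαi]
    · exact hi' k e
  have hβ'' : ∀ k, β k = sgn a * if k = j then 1 else 0 := by
    intro k
    split_ifs with e
    · rw [e, ha, mul_one]
    · rw [hj' k e, mul_zero]
  refine ⟨i, j, a, ?_⟩
  rintro ⟨k, b⟩
  rw [mul_assoc, ← hα'', ← hβ'']
  fin_cases b <;> (simp [α, β]; try ring)

theorem exists_eq_blockPerm_submatrix {P : Mat10} (hP : Pᵀ * P = 1)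
    (hv : ∀ v, IsSwitchingVector v → ∀ q, v ⬝ᵥ (fun p => P p q) = 0 ∨ v ⬝ᵥ (fun p => P p q) = 1) :
    ∃ (f : ZMod 5 → ZMod 5) (F : Equiv.Perm Vtx), Function.Injective f ∧
      P = (blockPerm f).submatrix id F := by
  have hentry : ∀ q q', ∑ p, P p q * P p q' = if q = q' then 1 else 0 := by
    intro q q'
    have := congrFun (congrFun hP q) q'
    rwa [Matrix.mul_apply, Matrix.one_apply] at this
  choose i j a hx using fun q => column_eq (x := fun p => P p q) (by simpa using hentry q q)
    (fun v h => hv v h q)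
  have horth : ∀ q q', ((if i q = i q' then (1 : ℝ) else 0) +
      sgn (a q) * sgn (a q') * (if j q = j q' then 1 else 0)) / 2 = if q = q' then 1 else 0 := by
    intro q q'
    rw [← hentry q q', Fintype.sum_prod_type]
    simp only [hx, Fin.sum_univ_two, sgn_zero, sgn_one]
    have : ∀ k,
        ((if k = i q then (1 : ℝ) else 0) + 1 * sgn (a q) * (if k = j q then 1 else 0)) / 2 *
        (((if k = i q' then (1 : ℝ) else 0) + 1 * sgn (a q') * (if k = j q' then 1 else 0)) / 2) +
        ((if k = i q then (1 : ℝ) else 0) + -1 * sgn (a q) * (if k = j q then 1 else 0)) / 2 *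
        (((if k = i q' then (1 : ℝ) else 0) + -1 * sgn (a q') * (if k = j q' then 1 else 0)) / 2) =
        (if k = i q then (if k = i q' then 1 / 2 else 0) else 0) +
        (if k = j q then (if k = j q' then sgn (a q) * sgn (a q') / 2 else 0) else 0) := by
      intro k
      split_ifs <;> ring
    rw [Finset.sum_congr rfl fun k _ => this k, Finset.sum_add_distrib, Finset.sum_ite_eq',
      Finset.sum_ite_eq']
    simp only [Finset.mem_univ, if_true]
    split_ifs <;> ring
  have hsq : ∀ a, sgn a * sgn a = 1 := by
    intro a
    fin_cases a <;> norm_num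
  have hsgn : ∀ a, sgn a ≠ 0 := by
    intro a
    fin_cases a <;> norm_num
  -- Otherwise the two columns would have inner product `1/2`.
  have hj : ∀ q q', i q = i q' → j q = j q' := by
    intro q q' h
    by_contra hne
    have h' := horth q q'
    rw [if_pos h, if_neg hne, if_neg (fun e => hne (by rw [e]))] at h'
    norm_num at h'
  have hinj : Function.Injective fun q => (i q, a q) := by
    intro q q' h
    obtain ⟨h₁, h₂⟩ := Prod.mk.inj h
    by_contra hne
    have h' := horth q q'
    rw [if_pos h₁, if_pos (hj q q' h₁), if_neg hne, h₂, hsq] at h'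
    norm_num at h'
  let F : Equiv.Perm Vtx := Equiv.ofBijective _ (Finite.injective_iff_bijective.1 hinj)
  have hF : ∀ q, F q = (i q, a q) := fun q => rfl
  have hF' : ∀ p, i (F.symm p) = p.1 := fun p => by
    conv_rhs => rw [← F.apply_symm_apply p, hF]
  refine ⟨fun k => j (F.symm (k, 0)), F, ?_, ?_⟩
  · intro k k' h
    by_contra hne
    have h' := horth (F.symm (k, 0)) (F.symm (k', 0))
    rw [hF', hF', if_neg hne, if_pos h,
      if_neg (fun e => hne (congrArg Prod.fst (F.symm.injective e)))] at h'
    have := mul_ne_zero (hsgn (a (F.symm (k, 0)))) (hsgn (a (F.symm (k', 0))))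
    apply this
    linarith
  · ext p q
    rw [show P p q = _ from hx q p]
    simp only [blockPerm, Matrix.submatrix_apply, Matrix.of_apply, id, hF,
      hj (F.symm (i q, 0)) q (hF' _)]

/-- Cancelling the permutation matrix `P` would make the decomposable `X` a copy of `R10` with
permuted rows and columns. -/
lemma prefix_ne_blockPerm_succ {P X : Mat10} {F G : Equiv.Perm Vtx}
    (hP : P = (1 : Mat10).submatrix id F) (hX : IsDecomposable X) :
    P * X ≠ (blockPerm succ5).submatrix id G := by
  intro h
  have hX' : X = (blockPerm succ5).submatrix F G := by
    ext p q
    have := congrFun (congrFun h (F p)) q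
    rw [Matrix.mul_apply, Finset.sum_eq_single p] at this
    · rw [hP] at this
      change (1 : Mat10) (F p) (F p) * X p q = blockPerm succ5 (F p) (G q) at this
      rwa [Matrix.one_apply_eq, one_mul] at this
    · intro r _ hr
      rw [hP, Matrix.submatrix_apply, id, Matrix.one_apply_ne (fun e => hr (F.injective e).symm),
        zero_mul]
    · simp
  exact not_isDecomposable_submatrix F G (hX' ▸ hX)

lemma isSwitchable_fromBlocks {B : Mat10} (hB : B ∈ BSet R10) {v : Vtx → ℝ}
    (hv : IsSwitchingVector v) :
    IsSwitchable R10 B 1 (Matrix.fromBlocks B (Matrix.of fun p _ => v p)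
      (Matrix.of fun _ p => v p) 0) := by
  have hA : (Matrix.fromBlocks B (Matrix.of fun p (_ : Fin 1) => v p)
      (Matrix.of fun _ p => v p) 0).IsAdjMatrix := by
    refine ⟨?_, ?_, ?_⟩
    · rintro (p | p) (q | q)
      · exact hB.1.zero_or_one p q
      · exact hv.1 p
      · exact hv.1 q
      · exact Or.inl rfl
    · refine Matrix.IsSymm.ext ?_
      rintro (p | p) (q | q)
      · exact hB.1.symm.apply p q
      all_goals rfl
    · rintro (p | p)
      · exact hB.1.apply_diag p
      · rfl
  refine ⟨hA, by simp, ?_⟩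
  rw [isAdjMatrix_extend_conj_iff hA, Matrix.toBlocks_fromBlocks₁₁, Matrix.toBlocks_fromBlocks₁₂]
  refine ⟨hB.2, fun p w => ?_⟩
  obtain rfl : w = 0 := Subsingleton.elim _ _
  have : (R10ᵀ * Matrix.of fun p (_ : Fin 1) => v p) p 0 = v ⬝ᵥ fun r => R10 r p := by
    simp [Matrix.mul_apply, dotProduct, mul_comm]
  rw [this]
  exact hv.2 p

theorem not_isReducible {B : Mat10} {k : Fin 3} (hB : B ∈ BSet R10)
    (ht : HasBlockTypes B (caseTable k)) : ¬ IsReducible R10 B := by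
  rintro ⟨L, hL, hprod, hA⟩
  have horth : ∀ i, ((L.take i).prod)ᵀ * (L.take i).prod = 1 := by
    intro i
    exact (Matrix.mem_orthogonalGroup_iff' _ _).1
      (Submonoid.list_prod_mem _ fun M hM => (hL M (List.mem_of_mem_take hM)).1.1)
  have hform : ∀ i < L.length, ∃ F : Equiv.Perm Vtx,
      (L.take i).prod = (1 : Mat10).submatrix id F ∨
        (L.take i).prod = (blockPerm succ5).submatrix id F := by
    intro i hi
    have hsw : ∀ v, IsSwitchingVector v →
        (((L.take i).prod)ᵀ * B * (L.take i).prod).IsAdjMatrix ∧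
          ∀ q, v ⬝ᵥ (fun p => (L.take i).prod p q) = 0 ∨
            v ⬝ᵥ (fun p => (L.take i).prod p q) = 1 := by
      intro v hv
      have hs := isSwitchable_fromBlocks hB hv
      have h := hA 1 _ hs i hi
      rw [prod_map_extend, isAdjMatrix_extend_conj_iff hs.1, Matrix.toBlocks_fromBlocks₁₁,
        Matrix.toBlocks_fromBlocks₁₂] at h
      refine ⟨h.1, fun q => ?_⟩
      have h' := h.2 q 0
      have e : (((L.take i).prod)ᵀ * Matrix.of fun p (_ : Fin 1) => v p) q 0 =
          v ⬝ᵥ fun p => (L.take i).prod p q := by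
        simp [Matrix.mul_apply, dotProduct, mul_comm]
      rwa [e] at h'
    obtain ⟨f, F, hf, hF⟩ := exists_eq_blockPerm_submatrix (horth i) fun v hv => (hsw v hv).2
    -- The choice of outside vertex is irrelevant here; an isolated one is used.
    have hadj := (hsw _ (isSwitchingVector_const ∅)).1
    have hconj : ((blockPerm f).submatrix id F)ᵀ * B * (blockPerm f).submatrix id F =
        ((blockPerm f)ᵀ * B * blockPerm f).submatrix F F := by
      ext p q
      simp [Matrix.mul_apply]
    rw [hF, hconj] at hadj
    have hadj' : ((blockPerm f)ᵀ * B * blockPerm f).IsAdjMatrix := by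
      refine ⟨fun p q => ?_, isSymm_conj ht.adj.symm _, fun p => ?_⟩
      · simpa using hadj.zero_or_one (F.symm p) (F.symm q)
      · simpa using hadj.apply_diag (F.symm p)
    rcases caseTable_valid k f hf ((ht.isAdjMatrix_conj_iff hf).1 hadj') with rfl | rfl
    · exact ⟨F, Or.inl (by rw [hF, blockPerm_id])⟩
    · exact ⟨F, Or.inr hF⟩
  -- By induction no proper prefix can jump from a permutation matrix to a copy of `R10`. The same
  -- jump is excluded below for the full product.
  have hid : ∀ i < L.length, ∃ F : Equiv.Perm Vtx,
      (L.take i).prod = (1 : Mat10).submatrix id F := by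
    intro i
    induction i with
    | zero => exact fun _ => ⟨Equiv.refl _, by simp⟩
    | succ i ih =>
      intro hi
      obtain ⟨F, hF⟩ := ih (by omega)
      obtain ⟨G, hG | hG⟩ := hform (i + 1) hi
      · exact ⟨G, hG⟩
      · rw [List.prod_take_succ L i (by omega)] at hG
        exact absurd hG (prefix_ne_blockPerm_succ hF (hL _ (List.getElem_mem _)).2)
  rcases Nat.eq_zero_or_pos L.length with h₀ | h₀
  · rw [List.eq_nil_of_length_eq_zero h₀, List.prod_nil, R10_eq] at hprod
    have := congrFun (congrFun hprod (0, 0)) (0, 0)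
    have h₁₀ : (1 : ZMod 5) ≠ 0 := by decide
    simp [blockPerm, h₁₀.symm] at this
  · obtain ⟨m, hm⟩ : ∃ m, L.length = m + 1 := ⟨L.length - 1, by omega⟩
    obtain ⟨F, hF⟩ := hid m (by omega)
    refine prefix_ne_blockPerm_succ (G := Equiv.refl _) hF (hL (L[m]'(by omega))
      (List.getElem_mem _)).2 ?_
    rw [← List.prod_take_succ L m (by omega), List.take_of_length_le (by omega), ← hprod, R10_eq]
    rfl

/-! ### The three cases -/

def BlockType.rep : BlockType → Mat2
  | .flat => 0
  | .diag => 1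
  | .row => N₂ᵀ
  | .col => N₂

lemma BlockType.rep_swap (τ : BlockType) : τ.swap.rep = τ.repᵀ := by
  cases τ <;> simp [rep, BlockType.swap]

lemma rep_firstType (k : Fin 3) : (firstType k).rep = firstBlk k := by
  fin_cases k <;> rfl

lemma rep_secondType (k : Fin 3) : (secondType k).rep = secondBlk k := by
  fin_cases k <;> rfl

lemma hasType_iff {B : Mat10} (hB : B.IsAdjMatrix) (i j : ZMod 5) (τ : BlockType) :
    HasType B i j τ ↔ blk B i j = τ.rep ∨ blk B i j = J₂ - τ.rep := by
  simp only [← Matrix.ext_iff, Fin.forall_fin_two, blk, Matrix.of_apply, Matrix.sub_apply, J₂]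
  cases τ <;> simp only [HasType, sumC, rowC, colC, diagC, rep, N₂] <;>
  rcases hB.zero_or_one (i, 0) (j, 0) with h₁ | h₁ <;>
  rcases hB.zero_or_one (i, 0) (j, 1) with h₂ | h₂ <;>
  rcases hB.zero_or_one (i, 1) (j, 0) with h₃ | h₃ <;>
  rcases hB.zero_or_one (i, 1) (j, 1) with h₄ | h₄ <;>
  rw [h₁, h₂, h₃, h₄] <;> norm_num

lemma caseTable_spec : ∀ k i, caseTable k i i = flat ∧ caseTable k i (i + 1) = firstType k ∧
    caseTable k i (i + 2) = secondType k ∧ caseTable k i (i + 3) = (secondType k).swap ∧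
    caseTable k i (i + 4) = (firstType k).swap := by
  decide +kernel

lemma caseTable_swap : ∀ k i j, caseTable k j i = (caseTable k i j).swap := by
  decide +kernel

lemma IsTenVertexCase.hasBlockTypes {k : Fin 3} {B : Mat10} (h : IsTenVertexCase k B) :
    HasBlockTypes B (caseTable k) := by
  obtain ⟨hA, h⟩ := h
  have h₁ : ∀ i, HasType B i (i + 1) (firstType k) := fun i =>
    (hasType_iff hA _ _ _).2 (by simpa only [rep_firstType] using (h i).2.1)
  have h₂ : ∀ i, HasType B i (i + 2) (secondType k) := fun i =>
    (hasType_iff hA _ _ _).2 (by simpa only [rep_secondType] using (h i).2.2)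
  have h₃ : ∀ i, HasType B i (i + 3) (secondType k).swap := fun i => by
    have := (h₂ (i + 3)).swap hA.symm
    rwa [add_assoc i, show (3 + 2 : ZMod 5) = 0 from rfl, add_zero] at this
  have h₄ : ∀ i, HasType B i (i + 4) (firstType k).swap := fun i => by
    have := (h₁ (i + 4)).swap hA.symm
    rwa [add_assoc i, show (4 + 1 : ZMod 5) = 0 from rfl, add_zero] at this
  refine ⟨hA, fun i => (caseTable_spec k i).1, fun i j hij => ?_, fun i j => ?_⟩
  · obtain ⟨-, e₁, e₂, e₃, e₄⟩ := caseTable_spec k i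
    have hn : j - i ≠ 0 := sub_ne_zero.2 (Ne.symm hij)
    rw [← add_sub_cancel i j]
    revert hn
    generalize j - i = n
    revert n
    refine forall_zmod5.2
      ⟨fun h => absurd rfl h, fun _ => ?_, fun _ => ?_, fun _ => ?_, fun _ => ?_⟩
    · exact e₁ ▸ h₁ i
    · exact e₂ ▸ h₂ i
    · exact e₃ ▸ h₃ i
    · exact e₄ ▸ h₄ i
  · have hz : ∀ i, B (i, 0) (i, 1) = 0 := fun i => congrFun (congrFun (h i).1 0) 1
    rw [hz, hz]

lemma HasBlockTypes.isTenVertexCase {k : Fin 3} {B : Mat10} (h : HasBlockTypes B (caseTable k))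
    (h₀ : B (0, 0) (0, 1) = 0) : IsTenVertexCase k B := by
  have hne : ∀ i : ZMod 5, i ≠ i + 1 ∧ i ≠ i + 2 := by decide
  refine ⟨h.adj, fun i => ⟨?_, ?_, ?_⟩⟩
  · have e₁ : B (i, 0) (i, 1) = 0 := (h.diag_const i 0).trans h₀
    have e₂ : B (i, 1) (i, 0) = 0 := (h.adj.symm.apply _ _).trans e₁
    ext a b
    fin_cases a <;> fin_cases b <;> simp [blk, h.adj.apply_diag, e₁, e₂]
  · have := h.hasType i (i + 1) (hne i).1
    rwa [hasType_iff h.adj, (caseTable_spec k i).2.1, rep_firstType] at this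
  · have := h.hasType i (i + 2) (hne i).2
    rwa [hasType_iff h.adj, (caseTable_spec k i).2.2.1, rep_secondType] at this

theorem IsTenVertexCase.mem_irreducibleSet {k : Fin 3} {B : Mat10} (h : IsTenVertexCase k B) :
    B ∈ IrreducibleSet R10 := by
  have ht := h.hasBlockTypes
  have hB : B ∈ BSet R10 := ⟨ht.adj, by
    rw [R10_eq, ht.isAdjMatrix_conj_iff (add_left_injective 1)]
    exact caseTable_valid_succ k⟩
  exact ⟨hB, not_isReducible hB ht⟩

theorem exists_isTenVertexCase (k : Fin 3) : ∃ B, IsTenVertexCase k B := by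
  let B : Mat10 := ofBlk fun i j => (caseTable k i j).rep
  have hblk : ∀ i j, blk B i j = (caseTable k i j).rep := fun i j => rfl
  have hA : B.IsAdjMatrix := by
    refine ⟨?_, ?_, ?_⟩
    · rintro ⟨i, a⟩ ⟨j, b⟩
      change (caseTable k i j).rep a b = 0 ∨ (caseTable k i j).rep a b = 1
      generalize caseTable k i j = τ
      cases τ <;> fin_cases a <;> fin_cases b <;> simp [rep, N₂]
    · refine Matrix.IsSymm.ext ?_
      rintro ⟨i, a⟩ ⟨j, b⟩
      change (caseTable k j i).rep b a = (caseTable k i j).rep a b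
      rw [caseTable_swap k i j, rep_swap, Matrix.transpose_apply]
    · rintro ⟨i, a⟩
      change (caseTable k i i).rep a a = 0
      rw [(caseTable_spec k i).1]
      rfl
  refine ⟨B, hA, fun i => ?_⟩
  obtain ⟨e₀, e₁, e₂, -⟩ := caseTable_spec k i
  rw [hblk, hblk, hblk, e₀, e₁, e₂, rep_firstType, rep_secondType]
  exact ⟨rfl, Or.inl rfl, Or.inl rfl⟩

lemma apply_eq_coef (B : Mat10) (i j : ZMod 5) (a b : Fin 2) :
    B (i, a) (j, b) = (sumC B i j + sgn b * rowC B i j + sgn a * colC B i j +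
      sgn a * sgn b * diagC B i j) / 4 := by
  simp only [sumC, rowC, colC, diagC]
  fin_cases a <;> fin_cases b <;> norm_num <;> ring

theorem IsTenVertexCase.isTenVertexSwitch {k : Fin 3} {B : Mat10} (h : IsTenVertexCase k B) :
    IsTenVertexSwitch k B (R10ᵀ * B * R10) := by
  have ht := h.hasBlockTypes
  refine ⟨h.mem_irreducibleSet.1.2, fun i => ?_⟩
  have hne : ∀ i : ZMod 5, i ≠ i + 1 ∧ i ≠ i + 2 ∧ i ≠ i + 3 := by decide
  have t₁ : ∀ i, HasType B i (i + 1) (firstType k) := fun i =>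
    (caseTable_spec k i).2.1 ▸ ht.hasType i (i + 1) (hne i).1
  have t₂ : ∀ i, HasType B i (i + 2) (secondType k) := fun i =>
    (caseTable_spec k i).2.2.1 ▸ ht.hasType i (i + 2) (hne i).2.1
  have t₃ : ∀ i, HasType B i (i + 3) (secondType k).swap := fun i =>
    (caseTable_spec k i).2.2.2.1 ▸ ht.hasType i (i + 3) (hne i).2.2
  have hd : ∀ i, sumC B i i = 0 ∧ rowC B i i = 0 ∧ colC B i i = 0 ∧ diagC B i i = 0 := by
    intro i
    have hz : B (i, 0) (i, 1) = 0 := congrFun (congrFun (h.2 i).1 0) 1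
    simpa [hz] using coef_self h.1 i
  have hr : rowC B i (i + 1) = 0 ∧ colC B (i + 1) i = 0 := by
    rw [colC_swap h.1.symm, and_self]
    have := t₁ i
    fin_cases k <;> exact this.2.1
  have e₁ : i + 1 + 1 = i + 2 := by rw [add_assoc]; rfl
  have e₂ : i + 2 + 1 = i + 3 := by rw [add_assoc]; rfl
  have e₃ : i + 1 + 2 = i + 3 := by rw [add_assoc]; rfl
  have u₁ := t₁ i
  have u₂ := t₁ (i + 1)
  have u₃ := t₂ i
  have u₄ := t₂ (i + 1)
  have u₅ := t₃ i
  rw [e₁] at u₂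
  rw [e₃] at u₄
  rw [R10_eq]
  refine ⟨?_, ?_, ?_⟩
  · ext a b
    rw [blk, Matrix.of_apply, conj_blockPerm_apply, (hd i).1, (hd (i + 1)).2.2.2, hr.1, hr.2]
    simp
  -- Besides the sum, at most one of the coefficients from `(i, i + 2)`, `(i + 1, i + 2)`, resp.
  -- `(i, i + 3)`, `(i + 1, i + 2)`, `(i + 1, i + 3)`, is nonzero. The block supplying it is the new
  -- block; in case (a) none survives at `(i, i + 1)`, which therefore stays.
  all_goals
    ext a b
    rw [blk, Matrix.of_apply, conj_blockPerm_apply]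
    simp only [succ5, e₁, e₂, (hd (i + 1)).2.2.1]
    fin_cases k <;>
    simp only [Fin.zero_eta, Fin.mk_one, Fin.reduceFinMk, blk, Matrix.of_apply, Matrix.cons_val,
      apply_eq_coef B, HasType, firstType, secondType, BlockType.swap] at u₁ u₂ u₃ u₄ u₅ ⊢ <;>
    simp only [u₁, u₂, u₃, u₄, u₅]

/-! ### Equivalence -/

lemma fullCompl_apply (B : Mat10) (p q : Vtx) :
    fullCompl B p q = 1 - (if p = q then 1 else 0) - B p q := by
  simp [fullCompl, Matrix.one_apply]

lemma fullCompl_apply_ne (B : Mat10) {i j : ZMod 5} (h : i ≠ j) (a b : Fin 2) :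
    fullCompl B (i, a) (j, b) = 1 - B (i, a) (j, b) := by
  rw [fullCompl_apply, if_neg (fun e => h (congrArg Prod.fst e)), sub_zero]

lemma HasBlockTypes.fullCompl {B : Mat10} {t : ZMod 5 → ZMod 5 → BlockType}
    (h : HasBlockTypes B t) : HasBlockTypes (fullCompl B) t := by
  refine ⟨⟨fun p q => ?_, Matrix.IsSymm.ext fun p q => ?_, fun p => ?_⟩, h.diag_flat,
    fun i j hij => ?_, fun i j => ?_⟩
  · rw [fullCompl_apply]
    by_cases hpq : p = q
    · subst hpq
      simp [h.adj.apply_diag]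
    · rcases h.adj.zero_or_one p q with e | e <;> simp [hpq, e]
  · simp only [fullCompl_apply, h.adj.symm.apply p q, eq_comm]
  · simp [fullCompl_apply, h.adj.apply_diag]
  · have := h.hasType i j hij
    have hs : sumC (TenVertex.fullCompl B) i j = 4 - sumC B i j := by
      simp only [sumC, fullCompl_apply_ne B hij]
      ring
    have hr : rowC (TenVertex.fullCompl B) i j = -rowC B i j := by
      simp only [rowC, fullCompl_apply_ne B hij]
      ring
    have hc : colC (TenVertex.fullCompl B) i j = -colC B i j := by
      simp only [colC, fullCompl_apply_ne B hij]
      ring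
    have hd : diagC (TenVertex.fullCompl B) i j = -diagC B i j := by
      simp only [diagC, fullCompl_apply_ne B hij]
      ring
    cases ht : t i j <;> rw [ht] at this <;> simp only [HasType, hs, hr, hc, hd] at this ⊢
    · refine ⟨?_, by linarith, by linarith, by linarith⟩
      rcases this.1 with e | e <;> rw [e] <;> norm_num
    · refine ⟨by linarith, by linarith, by linarith, ?_⟩
      rcases this.2.2.2 with e | e <;> rw [e] <;> norm_num
    · refine ⟨by linarith, ?_, by linarith, by linarith⟩
      rcases this.2.1 with e | e <;> rw [e] <;> norm_num
    · refine ⟨by linarith, by linarith, ?_, by linarith⟩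
      rcases this.2.2.1 with e | e <;> rw [e] <;> norm_num
  · simp only [fullCompl_apply, h.diag_const i j, Prod.mk.injEq, zero_ne_one, and_false]

theorem exists_equiv_isTenVertexCase {B : Mat10} (hB : B ∈ IrreducibleSet R10) :
    ∃ (k : Fin 3) (B' : Mat10), IsTenVertexCase k B' ∧ equivSetoid B B' := by
  obtain ⟨hB, hirr⟩ := hB
  obtain ⟨t, ht, hv⟩ := exists_hasBlockTypes hB
  rcases eq_caseTable_or_valid_factor ht.diag_flat ht.swap hv with ⟨k, rfl⟩ | ⟨w, hw, hw'⟩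
  -- The types do not see whether the parts are edges; if they are, the full complement removes
  -- these edges and keeps all types.
  · rcases ht.adj.zero_or_one (0, 0) (0, 1) with e | e
    · exact ⟨k, B, ht.isTenVertexCase e, Setoid.refl' _ B⟩
    · exact ⟨k, fullCompl B, ht.fullCompl.isTenVertexCase (by simp [fullCompl_apply, e]),
        Relation.EqvGen.rel _ _ Step.full⟩
  · exact absurd (ht.isReducible hw hw') hirr

/-- The pairs `{i, i + 1}` and `{i, i + 2}`. -/
def pairSnd (e : ZMod 5 × Fin 2) : ZMod 5 := e.1 + if e.2 = 0 then 1 else 2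

lemma pairSnd_ne : ∀ e : ZMod 5 × Fin 2, e.1 ≠ pairSnd e := by decide

/-- The ten indices name distinct unordered pairs of parts, so complementing one block leaves the
other nine untouched. -/
lemma pair_injective : ∀ e e' : ZMod 5 × Fin 2,
    (e'.1 = e.1 ∧ pairSnd e' = pairSnd e) ∨ (e'.1 = pairSnd e ∧ pairSnd e' = e.1) → e' = e := by
  decide +kernel

lemma blk_blockCompl (i j : ZMod 5) (B : Mat10) (k l : ZMod 5) :
    blk (blockCompl i j B) k l =
      if (k = i ∧ l = j) ∨ (k = j ∧ l = i) then J₂ - blk B k l else blk B k l := rfl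

lemma blockCompl_apply (i j : ZMod 5) (B : Mat10) (p q : Vtx) :
    blockCompl i j B p q =
      if (p.1 = i ∧ q.1 = j) ∨ (p.1 = j ∧ q.1 = i) then 1 - B p q else B p q := by
  have hJ : ∀ a b, J₂ a b = 1 := by
    intro a b
    fin_cases a <;> fin_cases b <;> rfl
  change (if (p.1 = i ∧ q.1 = j) ∨ (p.1 = j ∧ q.1 = i) then J₂ - blk B p.1 q.1
    else blk B p.1 q.1) p.2 q.2 = _
  split_ifs
  · rw [Matrix.sub_apply, hJ]
    rfl
  · rfl

lemma IsTenVertexCase.blockCompl {k : Fin 3} {B : Mat10} (h : IsTenVertexCase k B) {i j : ZMod 5}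
    (hij : i ≠ j) : IsTenVertexCase k (blockCompl i j B) := by
  obtain ⟨hA, h⟩ := h
  have hcond : ∀ k, ¬ ((k = i ∧ k = j) ∨ (k = j ∧ k = i)) := by
    rintro k (⟨rfl, h⟩ | ⟨rfl, h⟩)
    · exact hij h
    · exact hij h.symm
  refine ⟨⟨fun p q => ?_, Matrix.IsSymm.ext fun p q => ?_, fun p => ?_⟩, fun m => ?_⟩
  · rw [blockCompl_apply]
    rcases hA.zero_or_one p q with e | e <;> rw [e] <;> split_ifs <;> norm_num
  · rw [blockCompl_apply, blockCompl_apply, hA.symm.apply p q]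
    refine if_congr ?_ rfl rfl
    tauto
  · rw [blockCompl_apply, if_neg (hcond _), hA.apply_diag]
  · have hopt : ∀ {X M : Mat2} (c : Prop) [Decidable c], X = M ∨ X = J₂ - M →
        (if c then J₂ - X else X) = M ∨ (if c then J₂ - X else X) = J₂ - M := by
      rintro X M c _ (rfl | rfl) <;> split_ifs <;> simp
    simp only [blk_blockCompl]
    rw [if_neg (hcond m)]
    exact ⟨(h m).1, hopt _ (h m).2.1, hopt _ (h m).2.2⟩

lemma IsTenVertexCase.pair_cases {k : Fin 3} {B : Mat10} (h : IsTenVertexCase k B)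
    (e : ZMod 5 × Fin 2) :
    blk B e.1 (pairSnd e) = (if e.2 = 0 then firstBlk k else secondBlk k) ∨
      blk B e.1 (pairSnd e) = J₂ - if e.2 = 0 then firstBlk k else secondBlk k := by
  obtain ⟨i, a⟩ := e
  fin_cases a
  · exact (h.2 i).2.1
  · exact (h.2 i).2.2

lemma IsTenVertexCase.ext {k l : Fin 3} {B B' : Mat10} (h : IsTenVertexCase k B)
    (h' : IsTenVertexCase l B')
    (heq : ∀ e, blk B e.1 (pairSnd e) = blk B' e.1 (pairSnd e)) : B = B' := by
  have key : ∀ (i n : ZMod 5) (a b), B (i, a) (i + n, b) = B' (i, a) (i + n, b) := by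
    intro i n a b
    revert n
    have h₁ : ∀ i a b, B (i, a) (i + 1, b) = B' (i, a) (i + 1, b) := fun i a b =>
      congrFun (congrFun (heq (i, 0)) a) b
    have h₂ : ∀ i a b, B (i, a) (i + 2, b) = B' (i, a) (i + 2, b) := fun i a b =>
      congrFun (congrFun (heq (i, 1)) a) b
    refine forall_zmod5.2 ⟨?_, h₁ i a b, h₂ i a b, ?_, ?_⟩
    · rw [add_zero]
      exact congrFun (congrFun ((h.2 i).1.trans (h'.2 i).1.symm) a) b
    · rw [← h.1.symm.apply, ← h'.1.symm.apply]
      have := h₂ (i + 3) b a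
      rwa [add_assoc i, show (3 + 2 : ZMod 5) = 0 from rfl, add_zero] at this
    · rw [← h.1.symm.apply, ← h'.1.symm.apply]
      have := h₁ (i + 4) b a
      rwa [add_assoc i, show (4 + 1 : ZMod 5) = 0 from rfl, add_zero] at this
  ext ⟨i, a⟩ ⟨j, b⟩
  have := key i (j - i) a b
  rwa [add_sub_cancel] at this

theorem IsTenVertexCase.equiv {k : Fin 3} {B B' : Mat10} (h : IsTenVertexCase k B)
    (h' : IsTenVertexCase k B') : equivSetoid B B' := by
  -- Induction on a set `s` of pairs outside which the two matrices already agree; a disagreeing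
  -- block is the complement of its target.
  suffices ∀ (s : Finset (ZMod 5 × Fin 2)) (B : Mat10), IsTenVertexCase k B →
      (∀ e ∉ s, blk B e.1 (pairSnd e) = blk B' e.1 (pairSnd e)) → equivSetoid B B' from
    this Finset.univ B h fun e he => absurd (Finset.mem_univ e) he
  intro s
  induction s using Finset.induction_on with
  | empty =>
    intro B h heq
    rw [h.ext h' fun e => heq e (Finset.notMem_empty e)]
  | insert e s he ih =>
    intro B h heq
    by_cases hb : blk B e.1 (pairSnd e) = blk B' e.1 (pairSnd e)
    · refine ih B h fun e' he' => ?_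
      by_cases hee : e' = e
      · rw [hee, hb]
      · exact heq e' (by simp [hee, he'])
    · refine Setoid.trans' _ (Relation.EqvGen.rel _ _ (Step.block e.1 (pairSnd e) (pairSnd_ne e)))
        (ih _ (h.blockCompl (pairSnd_ne e)) fun e' he' => ?_)
      rw [blk_blockCompl]
      by_cases hee : e' = e
      · subst hee
        rw [if_pos (Or.inl ⟨rfl, rfl⟩)]
        rcases h.pair_cases e' with e₁ | e₁ <;> rcases h'.pair_cases e' with e₂ | e₂ <;>
          rw [e₁, e₂] at hb ⊢
        · exact absurd rfl hb
        · rw [sub_sub_cancel]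
        · exact absurd rfl hb
      · rw [if_neg fun hc => hee (pair_injective e e' hc)]
        exact heq e' (by simp [hee, he'])

/-! ### Invariants -/

def Near (p q : Vtx) : Prop := p.1 = q.1 + 1 ∨ q.1 = p.1 + 1

/-- All blocks between consecutive parts are constant. -/
def ConstNear (B : Mat10) : Prop :=
  ∀ p p' q q', p.1 = p'.1 → q.1 = q'.1 → Near p q → B p q = B p' q'

/-- All blocks between consecutive parts are constant on the diagonals. -/
def DiagNear (B : Mat10) : Prop :=
  ∀ p p' q q', p.1 = p'.1 → q.1 = q'.1 → p ≠ p' → q ≠ q' → Near p q → B p q = B p' q'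

lemma Near.ne {p q : Vtx} (h : Near p q) : p.1 ≠ q.1 := by
  have : ∀ i : ZMod 5, i ≠ i + 1 := by decide
  rcases h with h | h
  · rw [h]
    exact (this _).symm
  · rw [h]
    exact this _

lemma Near.congr {p p' q q' : Vtx} (h : Near p q) (hp : p.1 = p'.1) (hq : q.1 = q'.1) :
    Near p' q' := by
  rwa [Near, ← hp, ← hq]

section

variable {B C : Mat10}

lemma ConstNear.of_fullCompl (h : ConstNear (fullCompl B)) : ConstNear B := by
  intro p p' q q' hp hq hn
  have := h p p' q q' hp hq hn
  rw [fullCompl_apply, fullCompl_apply, if_neg (fun e => hn.ne (congrArg Prod.fst e)),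
    if_neg (fun e => (hn.congr hp hq).ne (congrArg Prod.fst e))] at this
  linarith

lemma DiagNear.of_fullCompl (h : DiagNear (fullCompl B)) : DiagNear B := by
  intro p p' q q' hp hq hp' hq' hn
  have := h p p' q q' hp hq hp' hq' hn
  rw [fullCompl_apply, fullCompl_apply, if_neg (fun e => hn.ne (congrArg Prod.fst e)),
    if_neg (fun e => (hn.congr hp hq).ne (congrArg Prod.fst e))] at this
  linarith

lemma fullCompl_fullCompl : fullCompl (fullCompl B) = B := by
  ext p q
  simp [fullCompl_apply]

lemma blockCompl_congr_iff (i j : ZMod 5) {p p' q q' : Vtx} (hp : p.1 = p'.1) (hq : q.1 = q'.1) :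
    blockCompl i j B p q = blockCompl i j B p' q' ↔ B p q = B p' q' := by
  rw [blockCompl_apply, blockCompl_apply, hp, hq]
  split_ifs
  · exact sub_right_inj
  · exact Iff.rfl

/-- A permutation that occurs as row permutation of an automorphism of `R₁₀` respects the parts
and their cyclic neighbourhood relation. -/
lemma respects_of_R10 {ρ ω : Equiv.Perm Vtx} (h : ∀ p q, R10 (ρ p) (ω q) = R10 p q) (p q : Vtx) :
    ((ρ p).1 = (ρ q).1 ↔ p.1 = q.1) ∧ (Near (ρ p) (ρ q) ↔ Near p q) := by
  have h₁₀ : (1 : ZMod 5) ≠ 0 := by decide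
  have hsupp : ∀ p q, R10 p q ≠ 0 ↔ (p.1 = q.1 ∨ p.1 = q.1 + 1) := by
    rintro ⟨i, a⟩ ⟨j, b⟩
    rw [R10_eq]
    by_cases h₁ : i = j
    · subst h₁
      fin_cases a <;> fin_cases b <;> simp [blockPerm, h₁₀]
    · by_cases h₂ : i = j + 1
      · subst h₂
        fin_cases a <;> fin_cases b <;> simp [blockPerm, h₁₀]
      · simp [blockPerm, h₁, h₂]
  -- Parts and their cyclic adjacency are read off from row supports: rows of one part have equal
  -- supports, and rows of different parts have intersecting supports exactly when the parts are
  -- consecutive.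
  have hsame : ∀ p q : Vtx, p.1 = q.1 ↔ ∀ r, (R10 p r ≠ 0 ↔ R10 q r ≠ 0) := by
    intro p q
    have key : ∀ i j : ZMod 5, (∀ k, (i = k ∨ i = k + 1) ↔ (j = k ∨ j = k + 1)) → i = j := by
      decide
    simp only [hsupp]
    exact ⟨fun h r => by rw [h], fun h => key _ _ fun k => h (k, 0)⟩
  have hnear : ∀ p q : Vtx, Near p q ↔ p.1 ≠ q.1 ∧ ∃ r, R10 p r ≠ 0 ∧ R10 q r ≠ 0 := by
    intro p q
    have key : ∀ i j : ZMod 5, i ≠ j → ∀ k, (i = k ∨ i = k + 1) → (j = k ∨ j = k + 1) →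
        i = j + 1 ∨ j = i + 1 := by
      decide
    simp only [hsupp]
    constructor
    · intro hn
      refine ⟨hn.ne, ?_⟩
      rcases hn with hn | hn
      · exact ⟨(q.1, 0), Or.inr hn, Or.inl rfl⟩
      · exact ⟨(p.1, 0), Or.inl rfl, Or.inr hn⟩
    · rintro ⟨hne, r, hp, hq⟩
      exact key _ _ hne _ hp hq
  have hs : (ρ p).1 = (ρ q).1 ↔ p.1 = q.1 := by
    rw [hsame, hsame, ← ω.forall_congr_right]
    simp only [h]
  refine ⟨hs, ?_⟩
  rw [hnear, hnear, ← ω.exists_congr_right]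
  simp only [h, ne_eq, hs]

lemma ConstNear.submatrix (hB : ConstNear B) {ρ : Equiv.Perm Vtx}
    (h : ∀ p q, ((ρ p).1 = (ρ q).1 ↔ p.1 = q.1) ∧ (Near (ρ p) (ρ q) ↔ Near p q)) :
    ConstNear (B.submatrix ρ ρ) := fun p p' q q' hp hq hn =>
  hB _ _ _ _ ((h p p').1.2 hp) ((h q q').1.2 hq) ((h p q).2.2 hn)

lemma DiagNear.submatrix (hB : DiagNear B) {ρ : Equiv.Perm Vtx}
    (h : ∀ p q, ((ρ p).1 = (ρ q).1 ↔ p.1 = q.1) ∧ (Near (ρ p) (ρ q) ↔ Near p q)) :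
    DiagNear (B.submatrix ρ ρ) := fun p p' q q' hp hq hp' hq' hn =>
  hB _ _ _ _ ((h p p').1.2 hp) ((h q q').1.2 hq) (fun e => hp' (ρ.injective e))
    (fun e => hq' (ρ.injective e)) ((h p q).2.2 hn)

lemma Step.invariant (h : Step B C) : (ConstNear B ↔ ConstNear C) ∧ (DiagNear B ↔ DiagNear C) := by
  cases h with
  | full =>
    have h₁ := fullCompl_fullCompl (B := B)
    exact ⟨⟨fun h => ConstNear.of_fullCompl (h₁.symm ▸ h), ConstNear.of_fullCompl⟩,
      ⟨fun h => DiagNear.of_fullCompl (h₁.symm ▸ h), DiagNear.of_fullCompl⟩⟩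
  | block i j _ =>
    refine ⟨?_, ?_⟩
    · refine forall₄_congr fun p p' q q' => forall₂_congr fun hp hq => ?_
      rw [blockCompl_congr_iff i j hp hq]
    · refine forall₄_congr fun p p' q q' => forall₂_congr fun hp hq => ?_
      rw [blockCompl_congr_iff i j hp hq]
  | conj σ τ h =>
    have hconj : ∀ (M : Mat10) (σ τ : Equiv.Perm Vtx),
        (σ.permMatrix ℝ)ᵀ * M * τ.permMatrix ℝ = M.submatrix σ.symm τ.symm := by
      intro M σ τ
      rw [Matrix.transpose_permMatrix, PEquiv.toMatrix_toPEquiv_mul, PEquiv.mul_toMatrix_toPEquiv,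
        Matrix.submatrix_submatrix]
      rfl
    rw [hconj] at h ⊢
    have hR : ∀ p q, R10 (σ.symm p) (τ.symm q) = R10 p q := fun p q => congrFun (congrFun h p) q
    have hR' : ∀ p q, R10 (σ p) (τ q) = R10 p q := fun p q => by
      rw [← hR (σ p) (τ q), σ.symm_apply_apply, τ.symm_apply_apply]
    have hB : (B.submatrix σ.symm σ.symm).submatrix σ σ = B := by
      simp [Matrix.submatrix_submatrix]
    exact ⟨⟨fun h => h.submatrix (respects_of_R10 hR),
      fun h => hB ▸ h.submatrix (respects_of_R10 hR')⟩,
      ⟨fun h => h.submatrix (respects_of_R10 hR),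
      fun h => hB ▸ h.submatrix (respects_of_R10 hR')⟩⟩

lemma invariant_of_equiv (h : equivSetoid B C) :
    (ConstNear B ↔ ConstNear C) ∧ (DiagNear B ↔ DiagNear C) := by
  induction h with
  | rel _ _ h => exact h.invariant
  | refl _ => exact ⟨Iff.rfl, Iff.rfl⟩
  | symm _ _ _ ih => exact ⟨ih.1.symm, ih.2.symm⟩
  | trans _ _ _ _ _ ih₁ ih₂ => exact ⟨ih₁.1.trans ih₂.1, ih₁.2.trans ih₂.2⟩

lemma DiagNear.of_forward (hB : B.IsSymm)
    (h : ∀ (i : ZMod 5) (a b : Fin 2),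
      B (i, a) (i + 1, b) = B (i, a + 1) (i + 1, b + 1)) : DiagNear B := by
  have hadd : ∀ a a' : Fin 2, a ≠ a' → a' = a + 1 := by decide
  rintro ⟨i, a⟩ ⟨i', a'⟩ ⟨j, b⟩ ⟨j', b'⟩ hp hq hp' hq' hn
  dsimp only at hp hq
  subst hp hq
  obtain rfl := hadd a a' (fun e => hp' (by rw [e]))
  obtain rfl := hadd b b' (fun e => hq' (by rw [e]))
  rcases hn with hn | hn
  · dsimp only at hn
    subst hn
    rw [← hB.apply, h, hB.apply]
  · dsimp only at hn
    subst hn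
    rw [h]

/-- Among `O`, `I`, `N` only `O` is constant, and only `N` fails to be constant on the diagonals;
hence this lemma and `diagNear_iff` together determine `k`. -/
lemma constNear_iff {k : Fin 3} (h : IsTenVertexCase k B) : ConstNear B ↔ k = 0 := by
  obtain ⟨hA, h⟩ := h
  constructor
  · intro hc
    have h₁ := (h 0).2.1
    have e : ∀ a a' b b', blk B 0 (0 + 1) a b = blk B 0 (0 + 1) a' b' := fun a a' b b' =>
      hc _ _ _ _ rfl rfl (Or.inr rfl)
    have e' := e 0 1 0 0
    by_contra hk
    rcases h₁ with h₁ | h₁ <;> rw [h₁] at e' <;> fin_cases k <;>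
      simp [firstBlk, N₂, J₂] at e' hk
  · rintro rfl
    have key : ∀ i a b a' b', B (i, a) (i + 1, b) = B (i, a') (i + 1, b') := by
      intro i a b a' b'
      change blk B i (i + 1) a b = blk B i (i + 1) a' b'
      rcases (h i).2.1 with e | e <;> rw [e] <;> fin_cases a <;> fin_cases b <;>
        fin_cases a' <;> fin_cases b' <;> simp [firstBlk, J₂]
    rintro ⟨i, a⟩ ⟨i', a'⟩ ⟨j, b⟩ ⟨j', b'⟩ hp hq hn
    dsimp only at hp hq
    subst hp hq
    rcases hn with hn | hn
    · dsimp only at hn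
      subst hn
      rw [← hA.symm.apply, key j b a b' a', hA.symm.apply]
    · dsimp only at hn
      subst hn
      exact key i a b a' b'

lemma diagNear_iff {k : Fin 3} (h : IsTenVertexCase k B) : DiagNear B ↔ k ≠ 2 := by
  obtain ⟨hA, h⟩ := h
  constructor
  · rintro hc rfl
    have e : blk B 0 (0 + 1) 0 0 = blk B 0 (0 + 1) 1 1 :=
      hc _ _ _ _ rfl rfl (by simp) (by simp) (Or.inr rfl)
    rcases (h 0).2.1 with h₁ | h₁ <;> rw [h₁] at e <;> simp [firstBlk, N₂, J₂] at e
  · intro hk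
    refine DiagNear.of_forward hA.symm fun i a b => ?_
    change blk B i (i + 1) a b = blk B i (i + 1) (a + 1) (b + 1)
    rcases (h i).2.1 with e | e <;> rw [e] <;> fin_cases k <;> fin_cases a <;> fin_cases b <;>
      first | exact absurd rfl hk | simp [firstBlk, J₂]

end

/-! ### Separating and counting the equivalence classes -/

theorem IsTenVertexCase.equiv_iff {k l : Fin 3} {B B' : Mat10} (h : IsTenVertexCase k B)
    (h' : IsTenVertexCase l B') : equivSetoid B B' ↔ k = l := by
  constructor
  · intro he
    obtain ⟨h₁, h₂⟩ := invariant_of_equiv he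
    rw [constNear_iff h, constNear_iff h'] at h₁
    rw [diagNear_iff h, diagNear_iff h'] at h₂
    clear h h' he
    revert h₁ h₂
    revert k l
    decide
  · rintro rfl
    exact h.equiv h'

theorem card_irreducibleClasses : Nat.card IrreducibleClasses = 3 := by
  choose B hB using exists_isTenVertexCase
  let s := equivSetoid.comap (Subtype.val : IrreducibleSet R10 → Mat10)
  let f : Fin 3 → IrreducibleClasses := fun k => Quotient.mk s ⟨B k, (hB k).mem_irreducibleSet⟩
  have hf : Function.Bijective f := by
    constructor
    · intro k l h
      have : equivSetoid (B k) (B l) := Quotient.exact (s := s) h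
      exact ((hB k).equiv_iff (hB l)).1 this
    · intro c
      induction c using Quotient.inductionOn with
      | h A =>
        obtain ⟨k, B', hk, he⟩ := exists_equiv_isTenVertexCase A.2
        refine ⟨k, Quotient.sound (s := s) ?_⟩
        exact Setoid.trans' equivSetoid ((hB k).equiv hk) (Setoid.symm' equivSetoid he)
  rw [← Nat.card_congr (Equiv.ofBijective f hf), Nat.card_fin]

end TenVertex

end

theorem theorem5p11 :
    -- up to equivalence there are exactly three irreducible matrices
    Nat.card TenVertex.IrreducibleClasses = 3 ∧
    -- each of the three cases occurs
    (∀ k : Fin 3, ∃ B, TenVertex.IsTenVertexCase k B) ∧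
    -- the matrices in the three cases are irreducible elements of `𝓑_{R₁₀}`
    (∀ (k : Fin 3) (B : TenVertex.Mat10), TenVertex.IsTenVertexCase k B →
      B ∈ TenVertex.IrreducibleSet TenVertex.R10) ∧
    -- each case lies in a single equivalence class, and the three classes are different
    (∀ (k l : Fin 3) (B B' : TenVertex.Mat10), TenVertex.IsTenVertexCase k B →
      TenVertex.IsTenVertexCase l B' → (TenVertex.equivSetoid B B' ↔ k = l)) ∧
    -- every irreducible matrix is equivalent to one of the three cases
    (∀ B ∈ TenVertex.IrreducibleSet TenVertex.R10, ∃ (k : Fin 3) (B' : TenVertex.Mat10),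
      TenVertex.IsTenVertexCase k B' ∧ TenVertex.equivSetoid B B') ∧
    -- the switching operation of `R₁₀` is the one of the respective case
    (∀ (k : Fin 3) (B : TenVertex.Mat10), TenVertex.IsTenVertexCase k B →
      TenVertex.IsTenVertexSwitch k B (TenVertex.R10ᵀ * B * TenVertex.R10)) := by
  open TenVertex in
  exact ⟨card_irreducibleClasses, exists_isTenVertexCase, fun _ _ h => h.mem_irreducibleSet,
    fun _ _ _ _ h h' => h.equiv_iff h', fun _ hB => exists_equiv_isTenVertexCase hB,
    fun _ _ h => h.isTenVertexSwitch⟩
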